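/- Let $S^2$ be the unit sphere of $\mathbb{R}^3$ with the spherical (angular) distance $|ab|$. A set $C\subset S^2$ is convex if it contains no pair of antipodes and contains, with any two points $a,b$, the shorter great-circle arc $ab$; a convex body is a closed convex set with non-empty interior, and a convex polygon is a convex body which is the convex hull of finitely many points of an open hemisphere. The disk of radius $\rho\in(0,\frac{\pi}{2}]$ centered at $p$ is $\{x\in S^2 : |px|\le\rho\}$; a hemisphere is a disk of radius $\frac{\pi}{2}$. A hemisphere $K$ supports a convex body $C$ if $C\subset K$ and $\mathrm{bd}(C)\cap \mathrm{bd}(K)\neq\emptyset$. A lune is the intersection $G\cap H$ of two different, non-opposite hemispheres, and its thickness is the spherical distance of the centers of the two semicircles $\mathrm{bd}(G)\cap H$ and $\mathrm{bd}(H)\cap G$ bounding it. For a hemisphere $K$ supporting $C$, the width of $C$ determined by $K$ is the minimum thickness of a lune $K\cap K'$ over all hemispheres $K'$ supporting $C$; the thickness $\Delta(C)$ is the smallest width of $C$ over all supporting hemispheres $K$. A convex body $R$ is reduced if $\Delta(K)<\Delta(R)$ for every convex body $K\subsetneq R$. Theorem. Let $V\subset S^2$ be a reduced convex polygon. Then $0<\Delta(V)\le\frac{\pi}{2}$,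 and $V$ is contained in the disk of radius $\Delta(V)$ centered at some boundary point of $V$. -/

import Mathlib

namespace SphericalPolygon

/-- The Euclidean space of dimension three. -/
abbrev E3 : Type := EuclideanSpace ℝ (Fin 3)

/-- The unit sphere `S²`, with its subspace topology. -/
abbrev S2 : Type := Metric.sphere (0 : E3) 1

/-- Spherical distance: the length of the shorter great-circle arc joining the points. -/
noncomputable def sdist (x y : S2) : ℝ := InnerProductGeometry.angle (x : E3) (y : E3)

/-- The closed disk with center `p` and radius `ρ`. -/
def disk (p : S2) (ρ : ℝ) : Set S2 := {x | sdist p x ≤ ρ}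

/-- The hemisphere with center `m`. -/
def hemisphere (m : S2) : Set S2 := disk m (Real.pi / 2)

/-- The arc `ab`: the part of the sphere in the convex cone spanned by `a` and `b`. For distinct
non-antipodal `a`, `b` it is the shorter of the two arcs of the great circle through them. -/
def arc (a b : S2) : Set S2 :=
  {x | ∃ s t : ℝ, 0 ≤ s ∧ 0 ≤ t ∧ (x : E3) = s • (a : E3) + t • (b : E3)}

/-- Convex subsets of the sphere: no antipodes, and all connecting arcs are contained. -/
def IsConvex (C : Set S2) : Prop :=
  (∀ a ∈ C, -a ∉ C) ∧ ∀ a ∈ C, ∀ b ∈ C, arc a b ⊆ C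

/-- A convex body: a closed convex set with non-empty interior. -/
def IsConvexBody (C : Set S2) : Prop :=
  IsConvex C ∧ IsClosed C ∧ (interior C).Nonempty

/-- The convex hull, meant for subsets of an open hemisphere. -/
def hull (A : Set S2) : Set S2 := ⋂₀ {C | IsConvex C ∧ A ⊆ C}

/-- A convex polygon: a convex body that is the convex hull of finitely many points of an open
hemisphere. -/
def IsPolygon (V : Set S2) : Prop :=
  IsConvexBody V ∧ ∃ F : Set S2, F.Finite ∧
    (∃ m : S2, ∀ x ∈ F, sdist m x < Real.pi / 2) ∧ V = hull F

/-- The hemisphere with center `m` supports `C`. -/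
def Supports (m : S2) (C : Set S2) : Prop :=
  C ⊆ hemisphere m ∧ (frontier C ∩ frontier (hemisphere m)).Nonempty

/-- The hemispheres with centers `g` and `h` are different and not opposite, so that their
intersection is a lune. -/
def IsLunePair (g h : S2) : Prop := g ≠ h ∧ g ≠ -h

/-- The center of the semicircle `G/H`, the part in `H` of the great circle bounding `G`, where
`G` and `H` are the hemispheres with centers `g` and `h`: the normalized projection of `h` to the
plane of that great circle (see `luneCenter_spec`). -/
noncomputable def luneCenter (g h : S2) : E3 :=
  ‖(h : E3) - (inner ℝ (g : E3) (h : E3)) • (g : E3)‖⁻¹ •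
    ((h : E3) - (inner ℝ (g : E3) (h : E3)) • (g : E3))

/-- For a lune, `luneCenter g h` is a point of the sphere on the great circle bounding the
hemisphere of `g`, and the semicircle `G/H` consists of the points of this great circle at
distance at most `π / 2` from it. -/
theorem luneCenter_spec {g h : S2} (hgh : IsLunePair g h) :
    ∃ c : S2, (c : E3) = luneCenter g h ∧ sdist g c = Real.pi / 2 ∧
      ∀ x : S2, sdist g x = Real.pi / 2 → (x ∈ hemisphere h ↔ sdist c x ≤ Real.pi / 2) := by
  have hg : ‖(g : E3)‖ = 1 := by simp
  have hh : ‖(h : E3)‖ = 1 := by simp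
  set w : E3 := (h : E3) - (inner ℝ (g : E3) (h : E3)) • (g : E3) with hw
  have hw0 : w ≠ 0 := by
    intro h0
    have e : (h : E3) = (inner ℝ (g : E3) (h : E3)) • (g : E3) := sub_eq_zero.mp h0
    have e2 := congrArg norm e
    rw [norm_smul, hg, hh, mul_one, Real.norm_eq_abs] at e2
    rcases (abs_eq zero_le_one).mp e2.symm with e3 | e3
    · rw [e3, one_smul] at e
      exact hgh.1 (Subtype.ext e.symm)
    · rw [e3, neg_one_smul] at e
      exact hgh.2 (Subtype.ext (by simp [e]))
  have hwn : 0 < ‖w‖⁻¹ := inv_pos.mpr (norm_pos_iff.mpr hw0)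
  have hc : ‖luneCenter g h‖ = 1 := by
    rw [luneCenter, ← hw, norm_smul, norm_inv, norm_norm,
      inv_mul_cancel₀ (norm_ne_zero_iff.mpr hw0)]
  have hgw : inner ℝ (g : E3) w = 0 := by
    rw [hw, inner_sub_right, inner_smul_right, real_inner_self_eq_norm_sq, hg]
    ring
  refine ⟨⟨luneCenter g h, by simpa using hc⟩, rfl, ?_, ?_⟩
  · refine (InnerProductGeometry.inner_eq_zero_iff_angle_eq_pi_div_two _ _).mp ?_
    change inner ℝ (g : E3) (luneCenter g h) = 0
    rw [luneCenter, ← hw, inner_smul_right, hgw, mul_zero]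
  · intro x hx
    have hgx : inner ℝ (g : E3) (x : E3) = 0 :=
      (InnerProductGeometry.inner_eq_zero_iff_angle_eq_pi_div_two _ _).mpr hx
    change InnerProductGeometry.angle (h : E3) (x : E3) ≤ _ ↔
      InnerProductGeometry.angle (luneCenter g h) (x : E3) ≤ _
    rw [luneCenter, ← hw, InnerProductGeometry.angle_smul_left_of_pos _ _ hwn,
      InnerProductGeometry.angle, InnerProductGeometry.angle, Real.arccos_le_pi_div_two,
      Real.arccos_le_pi_div_two]
    have hx1 : ‖(x : E3)‖ = 1 := by simp
    have e : inner ℝ w (x : E3) = inner ℝ (h : E3) (x : E3) := by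
      rw [hw, inner_sub_left, inner_smul_left, hgx]
      simp
    rw [e, hh, hx1, mul_one, mul_one, div_one, le_div_iff₀ (norm_pos_iff.mpr hw0), zero_mul]

/-- The thickness of the lune bounded by the hemispheres with centers `g` and `h`: the spherical
distance of the centers of its two bounding semicircles. -/
noncomputable def luneThickness (g h : S2) : ℝ :=
  InnerProductGeometry.angle (luneCenter g h) (luneCenter h g)

/-- The width of `C` determined by the supporting hemisphere with center `k`: the minimal
thickness of a lune cut out by it and another supporting hemisphere. -/
noncomputable def width (C : Set S2) (k : S2) : ℝ :=
  sInf {t | ∃ h : S2, Supports h C ∧ IsLunePair k h ∧ t = luneThickness k h}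

/-- The thickness of `C`: its smallest width. -/
noncomputable def thickness (C : Set S2) : ℝ :=
  sInf {t | ∃ k : S2, Supports k C ∧ t = width C k}

/-- A convex body is reduced if every convex body properly contained in it has smaller
thickness. -/
def IsReduced (R : Set S2) : Prop :=
  IsConvexBody R ∧ ∀ K : Set S2, IsConvexBody K → K ⊂ R → thickness K < thickness R

end SphericalPolygon

/-!
Cutting off a small piece at a vertex `v` of a reduced polygon `V` leaves a thinner convex body,
whose thinnest circumscribed lune has the center of one bounding semicircle on the cut. In the limit
one obtains, for every vertex `v`, a thinnest lune containing `V` whose semicircles are centered at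
`v` and at another point `t` of `V`, at distance `Δ(V)` from `v`. If this distance exceeded `π / 2`,
there would be only one supporting hemisphere with `v` on its boundary, whereas at a vertex there
are many. The lune is orthogonal to the arc `vt` at both endpoints. As a spherical quadrilateral
cannot have four angles of at most `π / 2`, no great circle has two of these arcs strictly on
different sides. By Crofton's formula the length of an arc is proportional to the measure of the
great circles which separate its endpoints. For a permutation `f` of some of the arcs, a great
circle separates `t i` from `v (f i)` for at most as many `i` as it separates `t i` from `v i`,
since it does not separate two arcs. If every `t i` had distance more than `Δ(V)` from some vertex
`v (f i)`, then `f` would permute a nonempty set of indices, and along this set the total length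
would grow, which is impossible. Hence all vertices, and therefore `V`, lie within distance `Δ(V)`
of some `t i`.
-/

namespace SphericalPolygon

open Filter Topology MeasureTheory
open scoped InnerProductSpace ENNReal

section InnerProductSpace

variable {E : Type*} [NormedAddCommGroup E] [InnerProductSpace ℝ E]

theorem mul_inner_le_of_eventually_mul_norm_le {g k w : E} {c : ℝ} (hg : ‖g‖ = 1)
    (hc : ⟪k, g⟫_ℝ = c) (h : ∀ᶠ ε in 𝓝[>] (0 : ℝ), c * ‖g + ε • w‖ ≤ ⟪k, g + ε • w⟫_ℝ) :
    c * ⟪g, w⟫_ℝ ≤ ⟪k, w⟫_ℝ := by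
  have hline : HasDerivAt (fun ε : ℝ => g + ε • w) w 0 := by
    simpa using ((hasDerivAt_id (0 : ℝ)).smul_const w).const_add g
  have hnorm : HasDerivAt (fun ε : ℝ => ‖g + ε • w‖) ⟪g, w⟫_ℝ 0 := by
    simpa [Real.sqrt_sq, hg] using hline.norm_sq.sqrt (by simp [hg])
  have hslope := (((innerSL ℝ k).hasFDerivAt.comp_hasDerivAt 0 hline).sub
    (hnorm.const_mul c)).tendsto_slope_zero_right
  refine sub_nonneg.mp (ge_of_tendsto hslope ?_)
  filter_upwards [h, self_mem_nhdsWithin] with ε hε hpos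
  have hpos : 0 < ε := hpos
  simpa [hg, hc] using mul_nonneg (inv_nonneg.mpr hpos.le) (sub_nonneg.mpr hε)

theorem isCompact_convexHull [FiniteDimensional ℝ E] {s : Set E} (hs : IsCompact s) :
    IsCompact (convexHull ℝ s) := by
  suffices hunion : convexHull ℝ s = ⋃ n ∈ Set.Iic (Module.finrank ℝ E + 1),
      (fun p : (Fin n → ℝ) × (Fin n → E) => ∑ i, p.1 i • p.2 i) ''
        (stdSimplex ℝ (Fin n) ×ˢ Set.univ.pi fun _ => s) by
    rw [hunion]
    exact (Set.finite_Iic _).isCompact_biUnion fun n _ =>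
      ((isCompact_stdSimplex ℝ _).prod (isCompact_univ_pi fun _ => hs)).image (by fun_prop)
  refine subset_antisymm (fun x hx => ?_) (Set.iUnion₂_subset fun n _ => ?_)
  · obtain ⟨ι, _, z, w, hz, hind, hw, hsum, rfl⟩ := eq_pos_convex_span_of_mem_convexHull hx
    let e := Fintype.equivFin ι
    refine Set.mem_biUnion (hind.card_le_finrank_succ.trans
      (Nat.succ_le_succ (Submodule.finrank_le _)))
      ⟨(w ∘ e.symm, z ∘ e.symm), ⟨⟨fun i => (hw _).le, ?_⟩, fun i _ => hz ⟨_, rfl⟩⟩, ?_⟩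
    · exact (e.symm.sum_comp w).trans hsum
    · exact e.symm.sum_comp fun i => w i • z i
  · rintro _ ⟨⟨w, z⟩, ⟨⟨hw, hsum⟩, hz⟩, rfl⟩
    exact (convex_convexHull ℝ s).sum_mem (fun i _ => hw i) hsum fun i _ =>
      subset_convexHull ℝ s (hz i trivial)

theorem exists_inner_pos_and_inner_nonpos [CompleteSpace E] {K : Set E} {z : E}
    (hK : IsCompact K) (hconv : Convex ℝ K) (hz : ∀ r : ℝ, 0 ≤ r → r • z ∉ K) :
    ∃ k : E, (∀ x ∈ K, 0 < ⟪k, x⟫_ℝ) ∧ ⟪k, z⟫_ℝ ≤ 0 := by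
  have hray_conv : Convex ℝ ((fun r : ℝ => r • z) '' Set.Ici 0) :=
    (convex_Ici 0).linear_image (LinearMap.toSpanSingleton ℝ E z)
  have hdisj : Disjoint K ((fun r : ℝ => r • z) '' Set.Ici 0) := by
    rw [Set.disjoint_right]
    rintro _ ⟨r, hr, rfl⟩
    exact hz r hr
  obtain ⟨f, u, v, hfK, huv, hfz⟩ := geometric_hahn_banach_compact_closed hconv hK hray_conv
    (isClosedMap_smul_left z _ isClosed_Ici) hdisj
  have hv : ∀ r : ℝ, 0 ≤ r → v < r * f z := fun r hr => by
    simpa using hfz _ (Set.mem_image_of_mem _ hr)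
  have hv0 : v < 0 := by simpa using hv 0 le_rfl
  have hfz0 : 0 ≤ f z := by
    by_contra! hneg
    simpa [hneg.ne] using hv (v / f z) (div_nonneg_of_nonpos hv0.le hneg.le)
  refine ⟨-(InnerProductSpace.toDual ℝ E).symm f, fun x hx => ?_, ?_⟩
  · simpa using (hfK x hx).trans (huv.trans hv0)
  · simpa using hfz0

/-- The lune orthogonal to the arc `vt` at both of its endpoints, as a cone: for linearly
independent unit vectors `v` and `t`, it is the set of all points which see both angles `xvt` and
`xtv` as at most right angles. -/
def perpLune (v t : E) : Set E :=
  {x | ⟪v, t⟫_ℝ * ⟪v, x⟫_ℝ ≤ ⟪t, x⟫_ℝ ∧ ⟪v, t⟫_ℝ * ⟪t, x⟫_ℝ ≤ ⟪v, x⟫_ℝ}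

theorem perpLune_comm (v t : E) : perpLune v t = perpLune t v := by
  ext x
  simp only [perpLune, Set.mem_ofPred_eq, real_inner_comm t v, and_comm]

/-- `v` and `t` are distinct unit vectors which form an angle of at most `π / 2`, so that they are
the endpoints of an arc of at most a quarter of a great circle. -/
structure IsShortArc (v t : E) : Prop where
  norm_left : ‖v‖ = 1
  norm_right : ‖t‖ = 1
  inner_nonneg : 0 ≤ ⟪v, t⟫_ℝ
  inner_lt_one : ⟪v, t⟫_ℝ < 1

theorem IsShortArc.symm {v t : E} (h : IsShortArc v t) : IsShortArc t v :=
  ⟨h.norm_right, h.norm_left, real_inner_comm t v ▸ h.inner_nonneg,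
    real_inner_comm t v ▸ h.inner_lt_one⟩

/-- The arcs `vt` and `uy` have length at most `π / 2`, and each of them lies in the lune which is
orthogonal to the other one at its endpoints. The thinnest lunes which contain a convex body lead to
such pairs of arcs, and on `S²` two such arcs have to meet. -/
structure MutualPerpLunes (v t u y : E) : Prop where
  short_left : IsShortArc v t
  short_right : IsShortArc u y
  u_mem : u ∈ perpLune v t
  y_mem : y ∈ perpLune v t
  v_mem : v ∈ perpLune u y
  t_mem : t ∈ perpLune u y

section MutualPerpLunes

variable {v t u y l : E} {a b c d : ℝ}

theorem MutualPerpLunes.symm (h : MutualPerpLunes v t u y) : MutualPerpLunes u y v t :=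
  ⟨h.short_right, h.short_left, h.v_mem, h.t_mem, h.u_mem, h.y_mem⟩

theorem MutualPerpLunes.swap_left (h : MutualPerpLunes v t u y) : MutualPerpLunes t v u y :=
  ⟨h.short_left.symm, h.short_right, perpLune_comm v t ▸ h.u_mem, perpLune_comm v t ▸ h.y_mem,
    h.t_mem, h.v_mem⟩

theorem MutualPerpLunes.swap_right (h : MutualPerpLunes v t u y) : MutualPerpLunes v t y u :=
  h.symm.swap_left.symm

theorem IsShortArc.inner_sub_smul_add (h : IsShortArc v t) :
    ⟪t - ⟪v, t⟫_ℝ • v, a • v + b • t⟫_ℝ = b * (1 - ⟪v, t⟫_ℝ ^ 2) := by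
  simp only [inner_add_right, inner_smul_right, inner_sub_left, inner_smul_left, conj_trivial,
    real_inner_self_eq_norm_sq, h.norm_left, h.norm_right, real_inner_comm v t]
  ring

theorem IsShortArc.one_sub_sq_pos (h : IsShortArc v t) : 0 < 1 - ⟪v, t⟫_ℝ ^ 2 := by
  nlinarith [h.inner_nonneg, h.inner_lt_one]

theorem MutualPerpLunes.le_mul_inner (h : MutualPerpLunes v t u y) (hc : 0 ≤ c) (hd : 0 ≤ d)
    (hrel : a • v + c • u = b • t + d • y) : b ≤ c * ⟪t, u⟫_ℝ := by
  have hproj : b * (1 - ⟪v, t⟫_ℝ ^ 2) =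
      c * (⟪t, u⟫_ℝ - ⟪v, t⟫_ℝ * ⟪v, u⟫_ℝ) - d * (⟪t, y⟫_ℝ - ⟪v, t⟫_ℝ * ⟪v, y⟫_ℝ) := by
    rw [← h.short_left.inner_sub_smul_add (a := -a),
      show (-a) • v + b • t = c • u - d • y by linear_combination (norm := module) -hrel]
    simp only [inner_sub_left, inner_sub_right, inner_smul_left, inner_smul_right, conj_trivial]
  have hfoot : ⟪t, u⟫_ℝ - ⟪v, t⟫_ℝ * ⟪v, u⟫_ℝ ≤ ⟪t, u⟫_ℝ * (1 - ⟪v, t⟫_ℝ ^ 2) := by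
    linarith [mul_le_mul_of_nonneg_left h.u_mem.2 h.short_left.inner_nonneg]
  refine le_of_mul_le_mul_right ?_ h.short_left.one_sub_sq_pos
  linarith [mul_le_mul_of_nonneg_left hfoot hc, mul_nonneg hd (sub_nonneg.mpr h.y_mem.1)]

theorem MutualPerpLunes.nonneg_of_add_eq (h : MutualPerpLunes v t u y) (ha : 0 ≤ a) (hb : 0 ≤ b)
    (hrel : a • v + b • t = c • u + d • y) : 0 ≤ c ∧ 0 ≤ d := by
  have hd : ∀ {u y : E} {c d : ℝ}, MutualPerpLunes v t u y → a • v + b • t = c • u + d • y →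
      0 ≤ d := by
    intro u y c d h hrel
    refine nonneg_of_mul_nonneg_left ?_ h.short_right.one_sub_sq_pos
    rw [← h.short_right.inner_sub_smul_add, ← hrel]
    simp only [inner_add_right, inner_smul_right, inner_sub_left, inner_smul_left, conj_trivial]
    exact add_nonneg (mul_nonneg ha (sub_nonneg.mpr h.v_mem.1))
      (mul_nonneg hb (sub_nonneg.mpr h.t_mem.1))
  exact ⟨hd h.swap_right (hrel.trans (add_comm _ _)), hd h hrel⟩

/-- With `a, b, c, d > 0`, the relation would make `v`, `t`, `u`, `y` the vertices of a
quadrilateral without obtuse angles, which does not exist on the sphere. -/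
theorem MutualPerpLunes.eq_zero_of_add_eq (h : MutualPerpLunes v t u y) (htu : t ≠ u) (hvy : v ≠ y)
    (ha : 0 ≤ a) (hb : 0 ≤ b) (hc : 0 ≤ c) (hd : 0 ≤ d)
    (hrel : a • v + c • u = b • t + d • y) : a = 0 ∧ b = 0 ∧ c = 0 ∧ d = 0 := by
  have eq_zero : ∀ {p q r : ℝ}, 0 ≤ p → 0 ≤ q → r < 1 → p ≤ q * r → q ≤ p * r → p = 0 ∧ q = 0 := by
    intro p q r hp hq hr hpq hqp
    constructor <;> nlinarith
  have htu1 : ⟪t, u⟫_ℝ < 1 := (inner_lt_one_iff_real_of_norm_eq_one h.short_left.norm_right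
    h.short_right.norm_left).mpr htu
  have hvy1 : ⟪v, y⟫_ℝ < 1 := (inner_lt_one_iff_real_of_norm_eq_one h.short_left.norm_left
    h.short_right.norm_right).mpr hvy
  have hbc : b ≤ c * ⟪t, u⟫_ℝ := h.le_mul_inner hc hd hrel
  have hcb : c ≤ b * ⟪t, u⟫_ℝ := real_inner_comm t u ▸
    h.swap_left.swap_right.symm.le_mul_inner hb ha (by rw [add_comm, ← hrel, add_comm])
  have had : a ≤ d * ⟪v, y⟫_ℝ := h.swap_left.swap_right.le_mul_inner hd hc hrel.symm
  have hda : d ≤ a * ⟪v, y⟫_ℝ := real_inner_comm v y ▸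
    h.symm.le_mul_inner ha hb (by rw [add_comm, hrel, add_comm])
  obtain ⟨hb0, hc0⟩ := eq_zero hb hc htu1 hbc hcb
  obtain ⟨ha0, hd0⟩ := eq_zero ha hd hvy1 had hda
  exact ⟨ha0, hb0, hc0, hd0⟩

theorem MutualPerpLunes.eq_zero_of_separated (h : MutualPerpLunes v t u y)
    (hv : 0 < ⟪l, v⟫_ℝ) (ht : 0 < ⟪l, t⟫_ℝ) (hu : ⟪l, u⟫_ℝ ≤ 0) (hy : ⟪l, y⟫_ℝ ≤ 0) (ha : 0 ≤ a)
    (hrel : a • v + b • t = c • u + d • y) : a = 0 ∧ b = 0 ∧ c = 0 ∧ d = 0 := by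
  have ne_of_separated : ∀ {x z : E}, 0 < ⟪l, x⟫_ℝ → ⟪l, z⟫_ℝ ≤ 0 → x ≠ z :=
    fun hx hz e => (hx.trans_le (e ▸ hz)).false
  have hl : a * ⟪l, v⟫_ℝ + b * ⟪l, t⟫_ℝ = c * ⟪l, u⟫_ℝ + d * ⟪l, y⟫_ℝ := by
    simpa only [inner_add_right, inner_smul_right] using congrArg (fun x => ⟪l, x⟫_ℝ) hrel
  rcases le_or_gt 0 b with hb | hb
  · obtain ⟨hc, hd⟩ := h.nonneg_of_add_eq ha hb hrel
    have ha0 : a = 0 := by nlinarith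
    have hb0 : b = 0 := by nlinarith
    obtain ⟨hc', hd'⟩ := h.nonneg_of_add_eq (a := 0) (b := 0) (c := -c) (d := -d) le_rfl le_rfl
      (by rw [ha0, hb0] at hrel; linear_combination (norm := module) -hrel)
    exact ⟨ha0, hb0, by linarith, by linarith⟩
  rcases le_or_gt 0 c with hc | hc <;> rcases le_or_gt 0 d with hd | hd
  · exact absurd (h.symm.nonneg_of_add_eq hc hd hrel.symm).2 hb.not_ge
  · obtain ⟨-, hd0, -, -⟩ := h.swap_right.eq_zero_of_add_eq (ne_of_separated ht hy)
      (ne_of_separated hv hu) ha (neg_nonneg.mpr hb.le) (neg_nonneg.mpr hd.le) hc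
      (by linear_combination (norm := module) hrel)
    exact absurd hd0 (by linarith)
  · obtain ⟨-, hd0, -, -⟩ := h.eq_zero_of_add_eq (ne_of_separated ht hu)
      (ne_of_separated hv hy) ha (neg_nonneg.mpr hb.le) (neg_nonneg.mpr hc.le) hd
      (by linear_combination (norm := module) hrel)
    exact absurd hd0 (by linarith)
  · nlinarith [h.symm.nonneg_of_add_eq (neg_nonneg.mpr hc.le) (neg_nonneg.mpr hd.le)
      (show (-c) • u + (-d) • y = (-a) • v + (-b) • t by linear_combination (norm := module) hrel)]

theorem MutualPerpLunes.linearIndependent_of_separated (h : MutualPerpLunes v t u y)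
    (hv : 0 < ⟪l, v⟫_ℝ) (ht : 0 < ⟪l, t⟫_ℝ) (hu : ⟪l, u⟫_ℝ ≤ 0) (hy : ⟪l, y⟫_ℝ ≤ 0) :
    LinearIndependent ℝ ![v, t, u, y] := by
  refine Fintype.linearIndependent_iff.mpr fun f hf => ?_
  simp only [Fin.sum_univ_four, Matrix.cons_val] at hf
  suffices f 0 = 0 ∧ f 1 = 0 ∧ f 2 = 0 ∧ f 3 = 0 by
    simpa [Fin.forall_fin_succ] using this
  rcases le_total 0 (f 0) with h0 | h0
  · simpa using h.eq_zero_of_separated hv ht hu hy h0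
      (show f 0 • v + f 1 • t = (-f 2) • u + (-f 3) • y by linear_combination (norm := module) hf)
  · simpa using h.eq_zero_of_separated hv ht hu hy (neg_nonneg.mpr h0)
      (show (-f 0) • v + (-f 1) • t = f 2 • u + f 3 • y by linear_combination (norm := module) -hf)

end MutualPerpLunes

end InnerProductSpace

section Crofton

variable {E : Type*} [NormedAddCommGroup E] [InnerProductSpace ℝ E]

/-- The hyperplanes through the origin which separate `a` from `b`, given by their normals in the
unit ball. By Crofton's formula, the volume of this set is proportional to the angle between `a`
and `b`. -/
def separating (a b : E) : Set E :=
  {u | u ∈ Metric.ball (0 : E) 1 ∧ ¬ (0 < ⟪u, a⟫_ℝ ↔ 0 < ⟪u, b⟫_ℝ)}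

theorem separating_smul_add_smul_subset {c d : E} {α β : ℝ} (hα : 0 < α) (hβ : 0 ≤ β) :
    separating c (α • c + β • d) ⊆ separating c d := by
  rintro u ⟨hball, hu⟩
  refine ⟨hball, fun hcd => hu ?_⟩
  rw [inner_add_right, inner_smul_right, inner_smul_right]
  rcases lt_or_ge 0 ⟪u, c⟫_ℝ with hc | hc
  · exact iff_of_true hc (add_pos_of_pos_of_nonneg (mul_pos hα hc) (mul_nonneg hβ (hcd.mp hc).le))
  · have hd : ⟪u, d⟫_ℝ ≤ 0 := not_lt.mp fun hd => hc.not_gt (hcd.mpr hd)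
    exact iff_of_false hc.not_gt (add_nonpos (mul_nonpos_of_nonneg_of_nonpos hα.le hc)
      (mul_nonpos_of_nonneg_of_nonpos hβ hd)).not_gt

theorem exists_linearIsometryEquiv_of_inner_eq {a b c e : E} (hac : ‖a‖ = ‖c‖) (hbe : ‖b‖ = ‖e‖)
    (h : ⟪a, b⟫_ℝ = ⟪c, e⟫_ℝ) : ∃ L : E ≃ₗᵢ[ℝ] E, L a = c ∧ L b = e := by
  let L₁ : E ≃ₗᵢ[ℝ] E := (ℝ ∙ (a - c))ᗮ.reflection
  have hL₁ : L₁ a = c := Submodule.reflection_sub hac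
  let L₂ : E ≃ₗᵢ[ℝ] E := (ℝ ∙ (L₁ b - e))ᗮ.reflection
  have hL₂ : L₂ (L₁ b) = e := Submodule.reflection_sub (by rw [L₁.norm_map, hbe])
  have hfix : L₂ c = c := by
    apply Submodule.reflection_mem_subspace_eq_self
    rw [Submodule.mem_orthogonal_singleton_iff_inner_left, inner_sub_right, ← h, ← hL₁,
      L₁.inner_map_map, sub_self]
  exact ⟨L₁.trans L₂, by simp [hL₁, hfix], by simp [hL₂]⟩

theorem exists_unit_smul_add_smul_of_lt_angle {c d : E} {θ : ℝ} (hc : ‖c‖ = 1) (hd : ‖d‖ = 1)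
    (hθ : 0 ≤ θ) (hθφ : θ < InnerProductGeometry.angle c d)
    (hπ : InnerProductGeometry.angle c d < Real.pi) :
    ∃ α β : ℝ, 0 < α ∧ 0 ≤ β ∧ ‖α • c + β • d‖ = 1 ∧ ⟪c, α • c + β • d⟫_ℝ = Real.cos θ := by
  set φ := InnerProductGeometry.angle c d
  have hsin : 0 < Real.sin φ := Real.sin_pos_of_pos_of_lt_pi (hθ.trans_lt hθφ) hπ
  have hcd : ⟪c, d⟫_ℝ = Real.cos φ := by simp [φ, InnerProductGeometry.cos_angle, hc, hd]
  refine ⟨Real.sin (φ - θ) / Real.sin φ, Real.sin θ / Real.sin φ,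
    div_pos (Real.sin_pos_of_pos_of_lt_pi (by linarith) (by linarith)) hsin,
    div_nonneg (Real.sin_nonneg_of_nonneg_of_le_pi hθ (by linarith)) hsin.le, ?_, ?_⟩
  · rw [← sq_eq_sq₀ (norm_nonneg _) zero_le_one, norm_add_sq_real, norm_smul, norm_smul, hc, hd,
      mul_one, mul_one, inner_smul_left, inner_smul_right, hcd, Real.norm_eq_abs, Real.norm_eq_abs,
      sq_abs, sq_abs, Real.sin_sub, conj_trivial]
    field_simp
    linear_combination Real.sin φ ^ 2 * Real.sin_sq_add_cos_sq θ
      - Real.sin θ ^ 2 * Real.sin_sq_add_cos_sq φ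
  · rw [inner_add_right, inner_smul_right, inner_smul_right, real_inner_self_eq_norm_sq, hc, hcd,
      Real.sin_sub]
    field_simp
    ring

theorem exists_mem_ball_inner_pos_inner_neg {c d : E} {α β : ℝ} (hc : ‖c‖ = 1) (hd : ‖d‖ = 1)
    (hcd : |⟪c, d⟫_ℝ| < 1) (hα : 0 < α) (hβ : 0 ≤ β) :
    ∃ u ∈ Metric.ball (0 : E) 1, 0 < ⟪u, c⟫_ℝ ∧ 0 < ⟪u, α • c + β • d⟫_ℝ ∧ ⟪u, d⟫_ℝ < 0 := by
  have hs : 0 < 1 - ⟪c, d⟫_ℝ ^ 2 := sub_pos.mpr ((sq_lt_one_iff_abs_lt_one _).mpr hcd)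
  -- the dual basis of `c`, `d`, combined so as to be positive at `α • c + β • d` as well
  set u : E := (β + 1) • (c - ⟪c, d⟫_ℝ • d) - α • (d - ⟪c, d⟫_ℝ • c) with hu
  have huc : ⟪u, c⟫_ℝ = (β + 1) * (1 - ⟪c, d⟫_ℝ ^ 2) := by
    simp only [hu, inner_sub_left, inner_smul_left, conj_trivial, real_inner_self_eq_norm_sq, hc,
      real_inner_comm c d]
    ring
  have hud : ⟪u, d⟫_ℝ = -(α * (1 - ⟪c, d⟫_ℝ ^ 2)) := by
    simp only [hu, inner_sub_left, inner_smul_left, conj_trivial, real_inner_self_eq_norm_sq, hd]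
    ring
  have hue : ⟪u, α • c + β • d⟫_ℝ = α * (1 - ⟪c, d⟫_ℝ ^ 2) := by
    rw [inner_add_right, inner_smul_right, inner_smul_right, huc, hud]
    ring
  have hn : 0 < (‖u‖ + 1)⁻¹ := by positivity
  refine ⟨(‖u‖ + 1)⁻¹ • u, ?_, ?_, ?_, ?_⟩
  · rw [mem_ball_zero_iff, norm_smul_of_nonneg hn.le, inv_mul_lt_one₀ (by positivity)]
    exact lt_add_one _
  · simpa only [real_inner_smul_left, huc] using by positivity
  · simpa only [real_inner_smul_left, hue] using by positivity
  · simpa only [real_inner_smul_left, hud, mul_neg, neg_lt_zero] using by positivity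

section Volume

variable [MeasurableSpace E] [BorelSpace E]

theorem measurableSet_separating (a b : E) : MeasurableSet (separating a b) := by
  have hhalf : ∀ c : E, MeasurableSet {u : E | 0 < ⟪u, c⟫_ℝ} := fun c =>
    (isOpen_lt continuous_const (by fun_prop)).measurableSet
  exact Metric.isOpen_ball.measurableSet.inter (((hhalf a).iff (hhalf b)).compl)

variable [FiniteDimensional ℝ E]

theorem volume_separating_lt_top (a b : E) : volume (separating a b) < ⊤ :=
  (measure_mono fun _ hu => hu.1).trans_lt (measure_ball_lt_top (x := (0 : E)) (r := 1))

theorem volume_separating_eq_of_inner_eq {a b c e : E} (hac : ‖a‖ = ‖c‖) (hbe : ‖b‖ = ‖e‖)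
    (h : ⟪a, b⟫_ℝ = ⟪c, e⟫_ℝ) : volume (separating a b) = volume (separating c e) := by
  obtain ⟨L, rfl, rfl⟩ := exists_linearIsometryEquiv_of_inner_eq hac hbe h
  rw [← L.measurePreserving.measure_preimage
    (measurableSet_separating (L a) (L b)).nullMeasurableSet]
  congr 1
  ext u
  simp [separating, L.inner_map_map]

theorem volume_separating_smul_add_smul_lt {c d : E} {α β : ℝ} (hc : ‖c‖ = 1) (hd : ‖d‖ = 1)
    (hcd : |⟪c, d⟫_ℝ| < 1) (hα : 0 < α) (hβ : 0 ≤ β) :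
    volume (separating c (α • c + β • d)) < volume (separating c d) := by
  let W : Set E := Metric.ball (0 : E) 1 ∩
    ({u | 0 < ⟪u, c⟫_ℝ} ∩ ({u | 0 < ⟪u, α • c + β • d⟫_ℝ} ∩ {u | ⟪u, d⟫_ℝ < 0}))
  have hW : IsOpen W := Metric.isOpen_ball.inter
    ((isOpen_lt continuous_const (by fun_prop)).inter
      ((isOpen_lt continuous_const (by fun_prop)).inter
        (isOpen_lt (by fun_prop) continuous_const)))
  have hne : W.Nonempty := exists_mem_ball_inner_pos_inner_neg hc hd hcd hα hβ
  have hdisj : Disjoint (separating c (α • c + β • d)) W :=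
    Set.disjoint_left.mpr fun u hu hW => hu.2 (iff_of_true hW.2.1 hW.2.2.1)
  have hsub : W ⊆ separating c d := fun u hu =>
    ⟨hu.1, fun hcd => (hcd.mp hu.2.1).not_gt hu.2.2.2⟩
  calc volume (separating c (α • c + β • d))
      < volume (separating c (α • c + β • d)) + volume W :=
        ENNReal.lt_add_right (volume_separating_lt_top _ _).ne (hW.measure_pos volume hne).ne'
    _ = volume (separating c (α • c + β • d) ∪ W) := (measure_union hdisj hW.measurableSet).symm
    _ ≤ volume (separating c d) :=
        measure_mono (Set.union_subset (separating_smul_add_smul_subset hα hβ) hsub)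

theorem volume_separating_lt_of_angle_lt {a b c d : E} (ha : ‖a‖ = 1) (hb : ‖b‖ = 1)
    (hc : ‖c‖ = 1) (hd : ‖d‖ = 1)
    (h : InnerProductGeometry.angle a b < InnerProductGeometry.angle c d)
    (hπ : InnerProductGeometry.angle c d < Real.pi) :
    volume (separating a b) < volume (separating c d) := by
  have hθ := InnerProductGeometry.angle_nonneg a b
  obtain ⟨α, β, hα, hβ, hnorm, hcos⟩ := exists_unit_smul_add_smul_of_lt_angle hc hd hθ h hπ
  have hcd : |⟪c, d⟫_ℝ| < 1 := by
    have hcos_cd : ⟪c, d⟫_ℝ = Real.cos (InnerProductGeometry.angle c d) := by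
      rw [InnerProductGeometry.cos_angle, hc, hd, mul_one, div_one]
    rw [← sq_lt_one_iff_abs_lt_one, hcos_cd, Real.cos_sq']
    exact sub_lt_self _ (pow_pos (Real.sin_pos_of_pos_of_lt_pi (hθ.trans_lt h) hπ) 2)
  calc volume (separating a b) = volume (separating c (α • c + β • d)) :=
        volume_separating_eq_of_inner_eq (ha.trans hc.symm) (hb.trans hnorm.symm)
          (by rw [hcos, InnerProductGeometry.cos_angle, ha, hb, mul_one, div_one])
    _ < volume (separating c d) := volume_separating_smul_add_smul_lt hc hd hcd hα hβ

end Volume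

open Classical in
theorem sum_ite_not_iff_comp_le {ι : Type*} {S : Finset ι} {f : ι → ι} (hf : Set.BijOn f S S)
    {P Q : ι → Prop} (h : ∀ i ∈ S, ¬ (P i ∧ Q i)) :
    ∑ i ∈ S, (if ¬ (P i ↔ Q (f i)) then (1 : ℝ≥0∞) else 0) ≤
      ∑ i ∈ S, (if ¬ (P i ↔ Q i) then (1 : ℝ≥0∞) else 0) := by
  have hle : ∀ i, (if ¬ (P i ↔ Q (f i)) then (1 : ℝ≥0∞) else 0) ≤
      (if P i then 1 else 0) + (if Q (f i) then 1 else 0) := fun i => by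
    by_cases hP : P i <;> by_cases hQ : Q (f i) <;> simp [hP, hQ]
  have heq : ∀ i ∈ S, (if P i then (1 : ℝ≥0∞) else 0) + (if Q i then 1 else 0) =
      if ¬ (P i ↔ Q i) then 1 else 0 := fun i hi => by
    by_cases hP : P i <;> by_cases hQ : Q i <;> simp_all
  have hcomp : ∑ i ∈ S, (if Q (f i) then (1 : ℝ≥0∞) else 0) = ∑ i ∈ S, if Q i then 1 else 0 :=
    Finset.sum_nbij f (fun i hi => hf.mapsTo hi) hf.injOn hf.surjOn fun i _ => rfl
  calc _ ≤ ∑ i ∈ S, ((if P i then (1 : ℝ≥0∞) else 0) + (if Q (f i) then 1 else 0)) :=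
        Finset.sum_le_sum fun i _ => hle i
    _ = ∑ i ∈ S, ((if P i then (1 : ℝ≥0∞) else 0) + (if Q i then 1 else 0)) := by
        rw [Finset.sum_add_distrib, hcomp, ← Finset.sum_add_distrib]
    _ = _ := Finset.sum_congr rfl heq

theorem sum_measure_le_sum_measure {α ι : Type*} [MeasurableSpace α] {μ : Measure α}
    {S : Finset ι} {A B : ι → Set α} (hA : ∀ i, MeasurableSet (A i)) (hB : ∀ i, MeasurableSet (B i))
    (h : ∀ x, ∑ i ∈ S, (A i).indicator (1 : α → ℝ≥0∞) x ≤ ∑ i ∈ S, (B i).indicator 1 x) :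
    ∑ i ∈ S, μ (A i) ≤ ∑ i ∈ S, μ (B i) := by
  have hsum : ∀ {C : ι → Set α}, (∀ i, MeasurableSet (C i)) →
      ∑ i ∈ S, μ (C i) = ∫⁻ x, ∑ i ∈ S, (C i).indicator (1 : α → ℝ≥0∞) x ∂μ := fun hC => by
    rw [lintegral_finsetSum _ fun i _ => measurable_one.indicator (hC i)]
    exact Finset.sum_congr rfl fun i _ => (lintegral_indicator_one (hC i)).symm
  rw [hsum hA, hsum hB]
  exact lintegral_mono h

theorem exists_finset_nonempty_bijOn {ι : Type*} [Finite ι] [Nonempty ι] (f : ι → ι) :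
    ∃ S : Finset ι, S.Nonempty ∧ Set.BijOn f S S := by
  classical
  have := Fintype.ofFinite ι
  obtain ⟨S, hS⟩ := exists_minimal_of_wellFoundedLT
    (fun S : Finset ι => S.Nonempty ∧ S.image f ⊆ S) ⟨Finset.univ, by simp⟩
  have himage : S.image f = S :=
    hS.eq_of_le ⟨hS.prop.1.image f, Finset.image_subset_image hS.prop.2⟩ hS.prop.2
  refine ⟨S, hS.prop.1, ?_, Finset.card_image_iff.mp (congrArg Finset.card himage), ?_⟩
  · exact fun i hi => himage ▸ Finset.mem_image_of_mem f hi
  · rw [Set.SurjOn, ← Finset.coe_image, himage]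

section Arcs

variable [MeasurableSpace E] [BorelSpace E] {ι : Type*} {t v : ι → E}

theorem sum_volume_separating_comp_le [FiniteDimensional ℝ E] {S : Finset ι} {f : ι → ι}
    (hf : Set.BijOn f S S)
    (hsep : ∀ i j l, 0 < ⟪l, t i⟫_ℝ → 0 < ⟪l, v i⟫_ℝ → ⟪l, t j⟫_ℝ ≤ 0 → 0 < ⟪l, v j⟫_ℝ) :
    ∑ i ∈ S, volume (separating (t i) (v (f i))) ≤ ∑ i ∈ S, volume (separating (t i) (v i)) := by
  classical
  refine sum_measure_le_sum_measure (fun i => measurableSet_separating _ _)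
    (fun i => measurableSet_separating _ _) fun u => ?_
  by_cases hu : u ∈ Metric.ball (0 : E) 1
  · simp only [Set.indicator_apply, separating, Set.mem_ofPred_eq, hu, true_and, Pi.one_apply]
    by_cases hpos : ∃ i, 0 < ⟪u, t i⟫_ℝ ∧ 0 < ⟪u, v i⟫_ℝ
    · obtain ⟨i, hti, hvi⟩ := hpos
      simpa only [not_iff_not] using sum_ite_not_iff_comp_le hf
        (P := fun i => ¬ 0 < ⟪u, t i⟫_ℝ) (Q := fun i => ¬ 0 < ⟪u, v i⟫_ℝ)
        fun j _ hj => hj.2 (hsep i j u hti hvi (not_lt.mp hj.1))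
    · exact sum_ite_not_iff_comp_le hf fun j _ hj => hpos ⟨j, hj⟩
  · simp only [Set.indicator_apply, separating, Set.mem_ofPred_eq, hu, false_and, if_false, le_refl]

theorem exists_forall_angle_le [FiniteDimensional ℝ E] [Finite ι] [Nonempty ι]
    (ht : ∀ i, ‖t i‖ = 1) (hv : ∀ i, ‖v i‖ = 1)
    (hπ : ∀ i j, InnerProductGeometry.angle (t i) (v j) < Real.pi)
    (hsep : ∀ i j l, 0 < ⟪l, t i⟫_ℝ → 0 < ⟪l, v i⟫_ℝ → ⟪l, t j⟫_ℝ ≤ 0 → 0 < ⟪l, v j⟫_ℝ) :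
    ∃ i, ∀ j, InnerProductGeometry.angle (t i) (v j) ≤ InnerProductGeometry.angle (t i) (v i) := by
  by_contra! hfar
  choose f hf using hfar
  obtain ⟨S, hS, hbij⟩ := exists_finset_nonempty_bijOn f
  exact (sum_volume_separating_comp_le hbij hsep).not_gt <|
    ENNReal.sum_lt_sum_of_nonempty hS fun i _ =>
      volume_separating_lt_of_angle_lt (ht i) (hv i) (ht i) (hv (f i)) (hf i) (hπ i (f i))

end Arcs

end Crofton

section Sphere

variable {x y k : S2} {C D : Set S2}

theorem norm_coe (x : S2) : ‖(x : E3)‖ = 1 := norm_eq_of_mem_sphere x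

theorem inner_coe_self (x : S2) : ⟪(x : E3), (x : E3)⟫_ℝ = 1 := by
  rw [real_inner_self_eq_norm_sq, norm_coe, one_pow]

theorem inner_coe_lt_one (hxy : x ≠ y) : ⟪(x : E3), (y : E3)⟫_ℝ < 1 :=
  (inner_lt_one_iff_real_of_norm_eq_one (norm_coe x) (norm_coe y)).mpr (Subtype.coe_ne_coe.mpr hxy)

theorem neg_one_lt_inner_coe (hxy : x ≠ -y) : -1 < ⟪(x : E3), (y : E3)⟫_ℝ := by
  have := inner_coe_lt_one hxy
  rw [coe_neg_sphere, inner_neg_right] at this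
  linarith

theorem cos_sdist (x y : S2) : Real.cos (sdist x y) = ⟪(x : E3), (y : E3)⟫_ℝ := by
  rw [sdist, InnerProductGeometry.cos_angle, norm_coe, norm_coe, mul_one, div_one]

theorem mem_hemisphere : x ∈ hemisphere k ↔ 0 ≤ ⟪(k : E3), (x : E3)⟫_ℝ := by
  change sdist k x ≤ Real.pi / 2 ↔ _
  rw [sdist, InnerProductGeometry.angle, Real.arccos_le_pi_div_two, norm_coe, norm_coe, mul_one,
    div_one]

theorem exists_eq_norm_smul_coe {z : E3} (hz : z ≠ 0) : ∃ x : S2, z = ‖z‖ • (x : E3) :=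
  ⟨⟨‖z‖⁻¹ • z, by simpa using norm_smul_inv_norm (𝕜 := ℝ) hz⟩,
    (smul_inv_smul₀ (norm_ne_zero_iff.mpr hz) z).symm⟩

theorem eq_of_coe_eq_smul {r : ℝ} (hr : 0 ≤ r) (hxy : (x : E3) = r • (y : E3)) : x = y := by
  have hr1 : r = 1 := by
    simpa [norm_smul_of_nonneg hr] using (congrArg norm hxy).symm
  exact Subtype.ext (by rw [hxy, hr1, one_smul])

/-- The cone over a subset of the sphere, without its apex. -/
def cone (C : Set S2) : Set E3 := {z | ∃ r : ℝ, 0 < r ∧ ∃ y ∈ C, z = r • (y : E3)}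

theorem coe_mem_cone_iff : (x : E3) ∈ cone C ↔ x ∈ C := by
  refine ⟨?_, fun hx => ⟨1, one_pos, x, hx, (one_smul ℝ _).symm⟩⟩
  rintro ⟨r, hr, y, hy, hxy⟩
  exact eq_of_coe_eq_smul hr.le hxy ▸ hy

theorem zero_notMem_cone (C : Set S2) : (0 : E3) ∉ cone C := by
  rintro ⟨r, hr, y, -, h⟩
  exact smul_ne_zero hr.ne' (ne_zero_of_mem_unit_sphere y) h.symm

theorem cone_mem_nhds (hx : x ∈ interior C) : cone C ∈ 𝓝 (x : E3) := by
  obtain ⟨U, hU, hUC⟩ := isOpen_induced_iff.mp (isOpen_interior (s := C))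
  have hx0 : (x : E3) ≠ 0 := ne_zero_of_mem_unit_sphere x
  have hcont : ContinuousAt (fun z : E3 => ‖z‖⁻¹ • z) x :=
    (continuousAt_id.norm.inv₀ (norm_ne_zero_iff.mpr hx0)).smul continuousAt_id
  have hxU : ‖(x : E3)‖⁻¹ • (x : E3) ∈ U := by
    rw [norm_coe, inv_one, one_smul]
    exact hUC.symm.subset hx
  filter_upwards [hcont (hU.mem_nhds hxU), isOpen_ne.mem_nhds hx0] with z hzU hz0
  obtain ⟨y, hy⟩ := exists_eq_norm_smul_coe hz0
  refine ⟨‖z‖, norm_pos_iff.mpr hz0, y, interior_subset (hUC.subset ?_), hy⟩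
  have hyz : (y : E3) = ‖z‖⁻¹ • z := by
    rw [eq_inv_smul_iff₀ (norm_ne_zero_iff.mpr hz0), ← hy]
  rwa [Set.mem_preimage, hyz]

theorem IsConvex.smul_add_smul_mem_cone (hC : IsConvex C) (hx : x ∈ C) (hy : y ∈ C) {a b : ℝ}
    (ha : 0 ≤ a) (hb : 0 ≤ b) (hab : 0 < a + b) : a • (x : E3) + b • (y : E3) ∈ cone C := by
  have hne : a • (x : E3) + b • (y : E3) ≠ 0 := fun h0 => by
    have hopp : a • (x : E3) = -(b • (y : E3)) := eq_neg_of_add_eq_zero_left h0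
    have heq : a = b := by
      simpa only [norm_neg, norm_smul_of_nonneg ha, norm_smul_of_nonneg hb, norm_coe, mul_one]
        using congrArg norm hopp
    have ha0 : a ≠ 0 := by
      rintro rfl
      linarith
    subst heq
    have hxy : x = -y := Subtype.ext (smul_right_injective E3 ha0 (by simpa using hopp))
    exact hC.1 y hy (hxy ▸ hx)
  obtain ⟨z, hz⟩ := exists_eq_norm_smul_coe hne
  have hpos := norm_pos_iff.mpr hne
  refine ⟨_, hpos, z, hC.2 x hx y hy ⟨_ / _, _ / _, div_nonneg ha hpos.le, div_nonneg hb hpos.le,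
    ?_⟩, hz⟩
  rw [div_eq_inv_mul, div_eq_inv_mul, mul_smul, mul_smul, ← smul_add, eq_inv_smul_iff₀ hpos.ne',
    ← hz]

theorem IsConvex.convex_cone (hC : IsConvex C) : Convex ℝ (cone C) := by
  rintro _ ⟨p, hp, x, hx, rfl⟩ _ ⟨q, hq, y, hy, rfl⟩ a b ha hb hab
  rw [smul_smul, smul_smul]
  refine hC.smul_add_smul_mem_cone hx hy (mul_nonneg ha hp.le) (mul_nonneg hb hq.le) ?_
  rcases ha.eq_or_lt with rfl | ha
  · exact add_pos_of_nonneg_of_pos (by simp) (mul_pos (by linarith) hq)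
  · exact add_pos_of_pos_of_nonneg (mul_pos ha hp) (mul_nonneg hb hq.le)

theorem IsConvex.exists_inner_pos_of_notMem (hD : IsConvex D) (hC : IsClosed C) (hCD : C ⊆ D)
    {z : E3} (hz : z ∉ cone D) :
    ∃ k : E3, (∀ y ∈ C, 0 < ⟪k, (y : E3)⟫_ℝ) ∧ ⟪k, z⟫_ℝ ≤ 0 := by
  have hsub : convexHull ℝ ((↑) '' C : Set E3) ⊆ cone D :=
    convexHull_min (Set.image_subset_iff.mpr fun y hy => coe_mem_cone_iff.mpr (hCD hy))
      hD.convex_cone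
  have hray : ∀ r : ℝ, 0 ≤ r → r • z ∉ convexHull ℝ ((↑) '' C : Set E3) := fun r hr hrz => by
    obtain ⟨q, hq, y, hy, hqy⟩ := hsub hrz
    have hr0 : r ≠ 0 := by
      rintro rfl
      exact zero_notMem_cone D (zero_smul ℝ z ▸ hsub hrz)
    refine hz ⟨r⁻¹ * q, mul_pos (inv_pos.mpr (hr.lt_of_ne' hr0)) hq, y, hy, ?_⟩
    rw [mul_smul, ← hqy, inv_smul_smul₀ hr0]
  obtain ⟨k, hk, hkz⟩ := exists_inner_pos_and_inner_nonpos
    (isCompact_convexHull (hC.isCompact.image continuous_subtype_val)) (convex_convexHull ℝ _) hray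
  exact ⟨k, fun y hy => hk y (subset_convexHull ℝ _ (Set.mem_image_of_mem _ hy)), hkz⟩

theorem IsConvex.exists_forall_inner_pos (hC : IsConvex C) (hcl : IsClosed C) :
    ∃ m : E3, ∀ x ∈ C, 0 < ⟪m, (x : E3)⟫_ℝ :=
  (hC.exists_inner_pos_of_notMem hcl subset_rfl (zero_notMem_cone C)).imp fun _ h => h.1

/-- The dual cone of `cone C`. Its unit vectors are the centers of the hemispheres containing
`C`. -/
def dualCone (C : Set S2) : Set E3 := {k | ∀ x ∈ C, 0 ≤ ⟪k, (x : E3)⟫_ℝ}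

theorem coe_mem_dualCone_iff : (k : E3) ∈ dualCone C ↔ C ⊆ hemisphere k :=
  forall₂_congr fun _ _ => mem_hemisphere.symm

theorem isClosed_dualCone (C : Set S2) : IsClosed (dualCone C) := by
  simp only [dualCone, Set.ofPred_forall]
  exact isClosed_biInter fun x _ => isClosed_le continuous_const (by fun_prop)

theorem smul_mem_dualCone {z : E3} {r : ℝ} (hr : 0 ≤ r) (hz : z ∈ dualCone C) :
    r • z ∈ dualCone C := fun x hx => by
  rw [real_inner_smul_left]
  exact mul_nonneg hr (hz x hx)

theorem add_mem_dualCone {z w : E3} (hz : z ∈ dualCone C) (hw : w ∈ dualCone C) :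
    z + w ∈ dualCone C := fun x hx => by
  rw [inner_add_left]
  exact add_nonneg (hz x hx) (hw x hx)

theorem exists_eq_norm_smul_mem_dualCone {z : E3} (hz : z ∈ dualCone C) (h0 : z ≠ 0) :
    ∃ k : S2, (k : E3) ∈ dualCone C ∧ z = ‖z‖ • (k : E3) := by
  obtain ⟨k, hk⟩ := exists_eq_norm_smul_coe h0
  refine ⟨k, ?_, hk⟩
  have : (k : E3) = ‖z‖⁻¹ • z := by
    rw [eq_inv_smul_iff₀ (norm_ne_zero_iff.mpr h0), ← hk]
  rw [this]
  exact smul_mem_dualCone (inv_nonneg.mpr (norm_nonneg z)) hz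

theorem inner_pos_of_mem_interior {z : E3} (hz : z ∈ dualCone C) (h0 : z ≠ 0)
    (hx : x ∈ interior C) : 0 < ⟪z, (x : E3)⟫_ℝ := by
  have hcont : ContinuousAt (fun ε : ℝ => (x : E3) - ε • z) 0 := by fun_prop
  have hcone : ∀ᶠ ε in 𝓝[>] (0 : ℝ), (x : E3) - ε • z ∈ cone C :=
    (hcont.eventually (by simpa using cone_mem_nhds hx)).filter_mono nhdsWithin_le_nhds
  obtain ⟨ε, ⟨r, hr, y, hy, heq⟩, hε⟩ := (hcone.and self_mem_nhdsWithin).exists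
  have hε : 0 < ε := hε
  have hnonneg : 0 ≤ ⟪z, (x : E3) - ε • z⟫_ℝ := by
    rw [heq, inner_smul_right]
    exact mul_nonneg hr.le (hz y hy)
  rw [inner_sub_right, inner_smul_right, real_inner_self_eq_norm_sq] at hnonneg
  have := mul_pos hε (pow_pos (norm_pos_iff.mpr h0) 2)
  linarith

theorem dualCone_mem_nhds {m : E3} (hcl : IsClosed C) (hm : ∀ x ∈ C, 0 < ⟪m, (x : E3)⟫_ℝ) :
    dualCone C ∈ 𝓝 m := by
  have hopen : IsOpen {p : E3 × S2 | 0 < ⟪p.1, (p.2 : E3)⟫_ℝ} :=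
    isOpen_lt continuous_const (by fun_prop)
  have hpos := hcl.isCompact.eventually_forall_of_forall_eventually
    (P := fun (z : E3) (x : S2) => 0 < ⟪z, (x : E3)⟫_ℝ) fun x hx => hopen.mem_nhds (hm x hx)
  filter_upwards [hpos] with z hz x hx
  exact (hz x hx).le

theorem IsConvex.mem_of_forall_dualCone (hC : IsConvex C) (hcl : IsClosed C)
    (hx : ∀ z ∈ dualCone C, 0 ≤ ⟪z, (x : E3)⟫_ℝ) : x ∈ C := by
  by_contra hxC
  obtain ⟨k, hk, hkx⟩ :=
    hC.exists_inner_pos_of_notMem hcl subset_rfl (coe_mem_cone_iff.not.mpr hxC)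
  have hcont : ContinuousAt (fun ε : ℝ => k - ε • (x : E3)) 0 := by fun_prop
  have hdual : ∀ᶠ ε in 𝓝[>] (0 : ℝ), k - ε • (x : E3) ∈ dualCone C :=
    (hcont.eventually (by simpa using dualCone_mem_nhds hcl hk)).filter_mono nhdsWithin_le_nhds
  obtain ⟨ε, hε, hpos⟩ := (hdual.and self_mem_nhdsWithin).exists
  have hle := hx _ hε
  rw [inner_sub_left, inner_smul_left, inner_coe_self] at hle
  simp only [conj_trivial] at hle
  linarith [show 0 < ε from hpos]

end Sphere

section Lune

variable {x g h : S2} {C : Set S2}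

theorem IsLunePair.symm (hgh : IsLunePair g h) : IsLunePair h g :=
  ⟨hgh.1.symm, fun heq => hgh.2 (by rw [heq, neg_neg])⟩

theorem IsLunePair.one_sub_sq_pos (hgh : IsLunePair g h) :
    0 < 1 - ⟪(g : E3), (h : E3)⟫_ℝ ^ 2 := by
  nlinarith [inner_coe_lt_one hgh.1, neg_one_lt_inner_coe hgh.2]

theorem IsLunePair.sqrt_pos (hgh : IsLunePair g h) :
    0 < √(1 - ⟪(g : E3), (h : E3)⟫_ℝ ^ 2) :=
  Real.sqrt_pos.mpr hgh.one_sub_sq_pos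

theorem norm_sub_inner_smul (g h : S2) :
    ‖(h : E3) - ⟪(g : E3), (h : E3)⟫_ℝ • (g : E3)‖ = √(1 - ⟪(g : E3), (h : E3)⟫_ℝ ^ 2) := by
  rw [← Real.sqrt_sq (norm_nonneg _), norm_sub_sq_real, inner_smul_right, real_inner_comm,
    norm_smul, mul_pow, norm_coe, norm_coe, Real.norm_eq_abs, sq_abs]
  ring_nf

theorem IsLunePair.sqrt_smul_luneCenter (hgh : IsLunePair g h) :
    √(1 - ⟪(g : E3), (h : E3)⟫_ℝ ^ 2) • luneCenter g h =
      (h : E3) - ⟪(g : E3), (h : E3)⟫_ℝ • (g : E3) := by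
  rw [luneCenter, norm_sub_inner_smul, smul_inv_smul₀ hgh.sqrt_pos.ne']

theorem IsLunePair.norm_luneCenter (hgh : IsLunePair g h) : ‖luneCenter g h‖ = 1 := by
  refine mul_left_cancel₀ hgh.sqrt_pos.ne' ?_
  rw [← norm_smul_of_nonneg hgh.sqrt_pos.le, hgh.sqrt_smul_luneCenter, norm_sub_inner_smul, mul_one]

theorem inner_luneCenter_self (g h : S2) : ⟪(g : E3), luneCenter g h⟫_ℝ = 0 := by
  rw [luneCenter, inner_smul_right, inner_sub_right, inner_smul_right, inner_coe_self, mul_one,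
    sub_self, mul_zero]

theorem IsLunePair.luneCenter_add_smul (hgh : IsLunePair g h) :
    luneCenter h g + ⟪(g : E3), (h : E3)⟫_ℝ • luneCenter g h =
      √(1 - ⟪(g : E3), (h : E3)⟫_ℝ ^ 2) • (g : E3) := by
  refine smul_right_injective E3 hgh.sqrt_pos.ne' ?_
  have hsymm := hgh.symm.sqrt_smul_luneCenter
  rw [real_inner_comm] at hsymm
  simp only [smul_add, smul_comm _ ⟪(g : E3), (h : E3)⟫_ℝ, hgh.sqrt_smul_luneCenter, hsymm]
  rw [smul_smul (√_), Real.mul_self_sqrt hgh.one_sub_sq_pos.le]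
  module

theorem IsLunePair.inner_luneCenter_luneCenter (hgh : IsLunePair g h) :
    ⟪luneCenter g h, luneCenter h g⟫_ℝ = -⟪(g : E3), (h : E3)⟫_ℝ := by
  have hinner := congrArg (fun z => ⟪luneCenter g h, z⟫_ℝ) hgh.luneCenter_add_smul
  simp only [inner_add_right, inner_smul_right, real_inner_self_eq_norm_sq, hgh.norm_luneCenter,
    real_inner_comm (g : E3) (luneCenter g h), inner_luneCenter_self] at hinner
  linarith

theorem IsLunePair.luneThickness_eq (hgh : IsLunePair g h) :
    luneThickness g h = Real.arccos (-⟪(g : E3), (h : E3)⟫_ℝ) := by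
  rw [luneThickness, InnerProductGeometry.angle, hgh.norm_luneCenter, hgh.symm.norm_luneCenter,
    hgh.inner_luneCenter_luneCenter, mul_one, div_one]

theorem IsLunePair.mul_inner_le (hgh : IsLunePair g h) (hg : (g : E3) ∈ dualCone C) (hx : x ∈ C) :
    -⟪(g : E3), (h : E3)⟫_ℝ * ⟪luneCenter g h, (x : E3)⟫_ℝ ≤ ⟪luneCenter h g, (x : E3)⟫_ℝ := by
  have hinner := congrArg (fun z => ⟪z, (x : E3)⟫_ℝ) hgh.luneCenter_add_smul
  simp only [inner_add_left, real_inner_smul_left] at hinner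
  linarith [mul_nonneg hgh.sqrt_pos.le (hg x hx)]

theorem IsLunePair.mem_perpLune (hgh : IsLunePair g h) (hg : (g : E3) ∈ dualCone C)
    (hh : (h : E3) ∈ dualCone C) (hx : x ∈ C) :
    (x : E3) ∈ perpLune (luneCenter g h) (luneCenter h g) := by
  rw [perpLune, Set.mem_ofPred_eq, hgh.inner_luneCenter_luneCenter]
  exact ⟨hgh.mul_inner_le hg hx, real_inner_comm (h : E3) g ▸ hgh.symm.mul_inner_le hh hx⟩

end Lune

section Thickness

variable {x g h k : S2} {C : Set S2}

theorem IsLunePair.luneThickness_le_luneThickness {a b : S2} (hgh : IsLunePair g h)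
    (hab : IsLunePair a b) (hle : ⟪(g : E3), (h : E3)⟫_ℝ ≤ ⟪(a : E3), (b : E3)⟫_ℝ) :
    luneThickness g h ≤ luneThickness a b := by
  rw [hgh.luneThickness_eq, hab.luneThickness_eq]
  exact Real.arccos_le_arccos (neg_le_neg hle)

theorem mem_frontier_of_inner_eq_zero (hk : (k : E3) ∈ dualCone C) (hx : x ∈ C)
    (h0 : ⟪(k : E3), (x : E3)⟫_ℝ = 0) : x ∈ frontier C :=
  ⟨subset_closure hx, fun hint =>
    (inner_pos_of_mem_interior hk (ne_zero_of_mem_unit_sphere k) hint).ne' h0⟩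

theorem supports_of_inner_eq_zero (hk : (k : E3) ∈ dualCone C) (hx : x ∈ C)
    (h0 : ⟪(k : E3), (x : E3)⟫_ℝ = 0) : Supports k C :=
  have hsub := coe_mem_dualCone_iff.mp hk
  ⟨hsub, x, mem_frontier_of_inner_eq_zero hk hx h0,
    mem_frontier_of_inner_eq_zero (coe_mem_dualCone_iff.mpr subset_rfl) (hsub hx) h0⟩

theorem Supports.coe_mem_dualCone (hk : Supports k C) : (k : E3) ∈ dualCone C :=
  coe_mem_dualCone_iff.mpr hk.1

/-- Among the centers of the hemispheres containing `C`, the point `h` is farthest from `k`. -/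
structure IsFarthest (C : Set S2) (k h : S2) : Prop where
  left_mem : (k : E3) ∈ dualCone C
  right_mem : (h : E3) ∈ dualCone C
  inner_le : ∀ z : S2, (z : E3) ∈ dualCone C → ⟪(k : E3), (h : E3)⟫_ℝ ≤ ⟪(k : E3), (z : E3)⟫_ℝ

theorem exists_isFarthest (hk : (k : E3) ∈ dualCone C) : ∃ h, IsFarthest C k h := by
  have hcompact : IsCompact {z : S2 | (z : E3) ∈ dualCone C} :=
    ((isClosed_dualCone C).preimage continuous_subtype_val).isCompact
  obtain ⟨h, hh, hmin⟩ := hcompact.exists_isMinOn ⟨k, hk⟩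
    (f := fun z : S2 => ⟪(k : E3), (z : E3)⟫_ℝ) (by fun_prop)
  exact ⟨h, hk, hh, fun z hz => hmin hz⟩

theorem IsFarthest.mul_norm_le (H : IsFarthest C k h) {z : E3} (hz : z ∈ dualCone C) :
    ⟪(k : E3), (h : E3)⟫_ℝ * ‖z‖ ≤ ⟪(k : E3), z⟫_ℝ := by
  rcases eq_or_ne z 0 with rfl | h0
  · simp only [norm_zero, mul_zero, inner_zero_right, le_refl]
  obtain ⟨y, hy, hzy⟩ := exists_eq_norm_smul_mem_dualCone hz h0
  calc ⟪(k : E3), (h : E3)⟫_ℝ * ‖z‖ ≤ ⟪(k : E3), (y : E3)⟫_ℝ * ‖z‖ := by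
        gcongr
        exact H.inner_le y hy
    _ = ⟪(k : E3), z⟫_ℝ := by rw [mul_comm, ← inner_smul_right, ← hzy]

theorem IsFarthest.mul_inner_le (H : IsFarthest C k h) {z : E3} (hz : z ∈ dualCone C) :
    ⟪(k : E3), (h : E3)⟫_ℝ * ⟪(h : E3), z⟫_ℝ ≤ ⟪(k : E3), z⟫_ℝ := by
  refine mul_inner_le_of_eventually_mul_norm_le (norm_coe h) rfl ?_
  filter_upwards [self_mem_nhdsWithin] with ε hε
  have hε : 0 < ε := hε
  exact H.mul_norm_le (add_mem_dualCone H.right_mem (smul_mem_dualCone hε.le hz))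

theorem IsConvexBody.exists_forall_inner_pos (hC : IsConvexBody C) :
    ∃ m : E3, m ≠ 0 ∧ ∀ x ∈ C, 0 < ⟪m, (x : E3)⟫_ℝ := by
  obtain ⟨m, hm⟩ := hC.1.exists_forall_inner_pos hC.2.1
  obtain ⟨x, hx⟩ := hC.2.2
  refine ⟨m, ?_, hm⟩
  rintro rfl
  simpa using hm x (interior_subset hx)

theorem exists_inner_eq_zero_notMem_span_singleton (v g : E3) :
    ∃ w : E3, ⟪v, w⟫_ℝ = 0 ∧ w ∉ Submodule.span ℝ {g} := by
  by_contra! hle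
  have hsub : (Submodule.span ℝ {v})ᗮ ≤ Submodule.span ℝ {g} := fun w hw =>
    hle w (Submodule.mem_orthogonal_singleton_iff_inner_right.mp hw)
  have hmono := Submodule.finrank_mono hsub
  have hadd := Submodule.finrank_add_finrank_orthogonal (Submodule.span ℝ {v})
  have hv := finrank_span_le_card (R := ℝ) ({v} : Set E3)
  have hg := finrank_span_le_card (R := ℝ) ({g} : Set E3)
  simp only [finrank_euclideanSpace_fin, Set.toFinset_singleton, Finset.card_singleton]
    at hadd hv hg
  omega

theorem IsConvexBody.not_dualCone_subset_span_singleton (hC : IsConvexBody C) (z : E3) :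
    ¬ dualCone C ⊆ Submodule.span ℝ {z} := by
  intro hsub
  obtain ⟨m, -, hm⟩ := hC.exists_forall_inner_pos
  have htop := (Submodule.span ℝ {z}).eq_top_of_nonempty_interior'
    ⟨m, mem_interior_iff_mem_nhds.mpr (mem_of_superset (dualCone_mem_nhds hC.2.1 hm) hsub)⟩
  obtain ⟨w, -, hw⟩ := exists_inner_eq_zero_notMem_span_singleton z z
  exact hw (htop ▸ Submodule.mem_top)

theorem IsFarthest.isLunePair (H : IsFarthest C k h) (hC : IsConvexBody C) : IsLunePair k h := by
  constructor
  · rintro rfl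
    refine hC.not_dualCone_subset_span_singleton k fun z hz => ?_
    have hle := H.mul_norm_le hz
    rw [inner_coe_self, one_mul] at hle
    have heq : ⟪(k : E3), z⟫_ℝ = ‖(k : E3)‖ * ‖z‖ := by
      refine (real_inner_le_norm _ _).antisymm ?_
      rwa [norm_coe, one_mul]
    rw [inner_eq_norm_mul_iff_real, norm_coe, one_smul] at heq
    exact Submodule.mem_span_singleton.mpr ⟨‖z‖, heq⟩
  · rintro rfl
    obtain ⟨x, hx⟩ := hC.2.2
    have hpos := inner_pos_of_mem_interior H.left_mem (ne_zero_of_mem_unit_sphere _) hx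
    rw [coe_neg_sphere, inner_neg_left] at hpos
    linarith [H.right_mem x (interior_subset hx)]

theorem IsFarthest.exists_coe_eq_luneCenter (H : IsFarthest C k h) (hC : IsConvexBody C) :
    ∃ v ∈ C, (v : E3) = luneCenter h k := by
  have hlune := (H.isLunePair hC).symm
  refine ⟨⟨luneCenter h k, mem_sphere_zero_iff_norm.mpr hlune.norm_luneCenter⟩, ?_, rfl⟩
  refine hC.1.mem_of_forall_dualCone hC.2.1 fun z hz => ?_
  refine nonneg_of_mul_nonneg_right (a := √(1 - ⟪(h : E3), (k : E3)⟫_ℝ ^ 2)) ?_ hlune.sqrt_pos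
  rw [← inner_smul_right, hlune.sqrt_smul_luneCenter, inner_sub_right, inner_smul_right,
    real_inner_comm (k : E3) h, real_inner_comm (k : E3) z, real_inner_comm (h : E3) z]
  exact sub_nonneg.mpr (H.mul_inner_le hz)

theorem IsFarthest.supports (H : IsFarthest C k h) (hC : IsConvexBody C) : Supports h C := by
  obtain ⟨v, hv, heq⟩ := H.exists_coe_eq_luneCenter hC
  exact supports_of_inner_eq_zero H.right_mem hv (heq ▸ inner_luneCenter_self h k)

theorem IsFarthest.width_eq (H : IsFarthest C k h) (hC : IsConvexBody C) :
    width C k = luneThickness k h := by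
  refine IsLeast.csInf_eq ⟨⟨h, H.supports hC, H.isLunePair hC, rfl⟩, ?_⟩
  rintro _ ⟨l, hl, hkl, rfl⟩
  exact (H.isLunePair hC).luneThickness_le_luneThickness hkl (H.inner_le l hl.coe_mem_dualCone)

/-- `g` and `h` are at maximal distance among the centers of the hemispheres containing `C`. -/
structure IsFarthestPair (C : Set S2) (g h : S2) : Prop where
  left_mem : (g : E3) ∈ dualCone C
  right_mem : (h : E3) ∈ dualCone C
  inner_le : ∀ a b : S2, (a : E3) ∈ dualCone C → (b : E3) ∈ dualCone C →
    ⟪(g : E3), (h : E3)⟫_ℝ ≤ ⟪(a : E3), (b : E3)⟫_ℝ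

theorem IsFarthestPair.symm (H : IsFarthestPair C g h) : IsFarthestPair C h g :=
  ⟨H.right_mem, H.left_mem, fun a b ha hb => by
    rw [real_inner_comm]
    exact H.inner_le a b ha hb⟩

theorem IsFarthestPair.isFarthest (H : IsFarthestPair C g h) : IsFarthest C g h :=
  ⟨H.left_mem, H.right_mem, fun z hz => H.inner_le g z H.left_mem hz⟩

theorem IsConvexBody.exists_isFarthestPair (hC : IsConvexBody C) : ∃ g h, IsFarthestPair C g h := by
  obtain ⟨m, hm0, hm⟩ := hC.exists_forall_inner_pos
  obtain ⟨k, hk, -⟩ := exists_eq_norm_smul_mem_dualCone (fun x hx => (hm x hx).le) hm0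
  have hcompact : IsCompact {z : S2 | (z : E3) ∈ dualCone C} :=
    ((isClosed_dualCone C).preimage continuous_subtype_val).isCompact
  obtain ⟨⟨g, h⟩, ⟨hg, hh⟩, hmin⟩ := (hcompact.prod hcompact).exists_isMinOn ⟨(k, k), hk, hk⟩
    (f := fun p : S2 × S2 => ⟪(p.1 : E3), (p.2 : E3)⟫_ℝ) (by fun_prop)
  exact ⟨g, h, hg, hh, fun a b ha hb => hmin (show (a, b) ∈ _ from ⟨ha, hb⟩)⟩

theorem IsFarthestPair.thickness_eq (H : IsFarthestPair C g h) (hC : IsConvexBody C) :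
    thickness C = luneThickness g h := by
  refine IsLeast.csInf_eq ⟨⟨g, H.symm.isFarthest.supports hC, (H.isFarthest.width_eq hC).symm⟩, ?_⟩
  rintro _ ⟨k, hk, rfl⟩
  obtain ⟨l, hl⟩ := exists_isFarthest hk.coe_mem_dualCone
  rw [hl.width_eq hC]
  exact (H.isFarthest.isLunePair hC).luneThickness_le_luneThickness (hl.isLunePair hC)
    (H.inner_le k l hl.left_mem hl.right_mem)

theorem IsConvexBody.thickness_pos (hC : IsConvexBody C) : 0 < thickness C := by
  obtain ⟨g, h, H⟩ := hC.exists_isFarthestPair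
  have hlune := H.isFarthest.isLunePair hC
  rw [H.thickness_eq hC, hlune.luneThickness_eq, Real.arccos_pos]
  linarith [neg_one_lt_inner_coe hlune.2]

end Thickness

section Reduced

variable {x v y g h g₀ h₀ : S2} {V : Set S2} {a k m : E3}

/-- The part of `V` on the nonnegative side of the plane orthogonal to `a`. -/
def cut (V : Set S2) (a : E3) : Set S2 := {x ∈ V | 0 ≤ ⟪a, (x : E3)⟫_ℝ}

theorem IsConvexBody.cut (hV : IsConvexBody V) (hx : x ∈ interior V) (hpos : 0 < ⟪a, (x : E3)⟫_ℝ) :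
    IsConvexBody (cut V a) := by
  refine ⟨⟨fun y hy hy' => hV.1.1 y hy.1 hy'.1, ?_⟩, ?_, x, ?_⟩
  · rintro y hy z hz w hw
    refine ⟨hV.1.2 y hy.1 z hz.1 hw, ?_⟩
    obtain ⟨s, t, hs, ht, heq⟩ := hw
    rw [heq, inner_add_right, inner_smul_right, inner_smul_right]
    exact add_nonneg (mul_nonneg hs hy.2) (mul_nonneg ht hz.2)
  · have hclosed : IsClosed {z : S2 | 0 ≤ ⟪a, (z : E3)⟫_ℝ} :=
      isClosed_le continuous_const (by fun_prop)
    exact hV.2.1.inter hclosed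
  · have hopen : IsOpen {z : S2 | 0 < ⟪a, (z : E3)⟫_ℝ} := isOpen_lt continuous_const (by fun_prop)
    exact mem_interior.mpr ⟨interior V ∩ {z : S2 | 0 < ⟪a, (z : E3)⟫_ℝ},
      fun z hz => ⟨interior_subset hz.1, le_of_lt hz.2⟩, isOpen_interior.inter hopen, hx, hpos⟩

theorem inner_eq_zero_of_mem_dualCone_cut (hV : IsConvex V) (hg : (g : E3) ∈ dualCone (cut V a))
    (hgV : (g : E3) ∉ dualCone V) (hy : y ∈ cut V a) (hgy : ⟪(g : E3), (y : E3)⟫_ℝ = 0) :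
    ⟪a, (y : E3)⟫_ℝ = 0 := by
  by_contra hne
  have hpos : 0 < ⟪a, (y : E3)⟫_ℝ := hy.2.lt_of_ne' hne
  obtain ⟨x, hx, hgx⟩ : ∃ x ∈ V, ⟪(g : E3), (x : E3)⟫_ℝ < 0 := by
    by_contra! hall
    exact hgV hall
  have hcont : ContinuousAt (fun ε : ℝ => ⟪a, (1 : ℝ) • (y : E3) + ε • (x : E3)⟫_ℝ) 0 := by fun_prop
  have hnear : ∀ᶠ ε in 𝓝[>] (0 : ℝ), 0 < ⟪a, (1 : ℝ) • (y : E3) + ε • (x : E3)⟫_ℝ :=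
    (hcont.eventually (lt_mem_nhds (by simpa using hpos))).filter_mono nhdsWithin_le_nhds
  obtain ⟨ε, haε, hε⟩ := (hnear.and self_mem_nhdsWithin).exists
  have hε : 0 < ε := hε
  obtain ⟨r, hr, z, hz, heq⟩ :=
    hV.smul_add_smul_mem_cone hy.1 hx zero_le_one hε.le (by positivity)
  rw [heq, inner_smul_right] at haε
  have hgz := hg z ⟨hz, (pos_of_mul_pos_right haε hr.le).le⟩
  have hginner := congrArg (fun w => ⟪(g : E3), w⟫_ℝ) heq
  simp only [inner_add_right, inner_smul_right, hgy] at hginner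
  nlinarith [mul_nonneg hr.le hgz]

theorem IsFarthestPair.notMem_dualCone_of_inner_lt (H : IsFarthestPair V g₀ h₀)
    (hlt : ⟪(g : E3), (h : E3)⟫_ℝ < ⟪(g₀ : E3), (h₀ : E3)⟫_ℝ) :
    (g : E3) ∉ dualCone V ∨ (h : E3) ∉ dualCone V := by
  by_contra! hmem
  exact (H.inner_le g h hmem.1 hmem.2).not_gt hlt

/-- The hemispheres centered at `g` and `h` contain `cut V a`, the distance of their centers has
cosine at most `c`, and `y`, the center of the semicircle in which the hemisphere of `h` meets the
boundary of that of `g`, lies on the plane orthogonal to `a`. The last equation avoids the junk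
value of `luneCenter g h` at `g = ±h`, so that it passes to limits of `g`, `h` and `y`. -/
structure IsCutLune (V : Set S2) (a : E3) (c : ℝ) (g h y : S2) : Prop where
  left_mem : (g : E3) ∈ dualCone (cut V a)
  right_mem : (h : E3) ∈ dualCone (cut V a)
  mem : y ∈ cut V a
  inner_eq_zero : ⟪a, (y : E3)⟫_ℝ = 0
  inner_le : ⟪(g : E3), (h : E3)⟫_ℝ ≤ c
  sqrt_smul : √(1 - ⟪(g : E3), (h : E3)⟫_ℝ ^ 2) • (y : E3) =
    (h : E3) - ⟪(g : E3), (h : E3)⟫_ℝ • (g : E3)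

theorem IsReduced.exists_isCutLune (hV : IsReduced V) (H₀ : IsFarthestPair V g₀ h₀)
    (hx : x ∈ interior V) (hax : 0 < ⟪a, (x : E3)⟫_ℝ) (hv : v ∈ V) (hav : ⟪a, (v : E3)⟫_ℝ < 0) :
    ∃ g h y, IsCutLune V a ⟪(g₀ : E3), (h₀ : E3)⟫_ℝ g h y := by
  have hcut := hV.1.cut hx hax
  obtain ⟨g, h, H⟩ := hcut.exists_isFarthestPair
  have hlt : ⟪(g : E3), (h : E3)⟫_ℝ < ⟪(g₀ : E3), (h₀ : E3)⟫_ℝ := by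
    by_contra! hle
    have hthin := hV.2 _ hcut ⟨fun z hz => hz.1, fun hsub => (hsub hv).2.not_gt hav⟩
    rw [H.thickness_eq hcut, H₀.thickness_eq hV.1] at hthin
    exact hthin.not_ge ((H₀.isFarthest.isLunePair hV.1).luneThickness_le_luneThickness
      (H.isFarthest.isLunePair hcut) hle)
  wlog hg : (g : E3) ∉ dualCone V generalizing g h
  · exact this h g H.symm (by rwa [real_inner_comm])
      ((H₀.notMem_dualCone_of_inner_lt hlt).resolve_left hg)
  obtain ⟨y, hy, heq⟩ := H.symm.isFarthest.exists_coe_eq_luneCenter hcut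
  refine ⟨g, h, y, H.left_mem, H.right_mem, hy, ?_, hlt.le, ?_⟩
  · exact inner_eq_zero_of_mem_dualCone_cut hV.1.1 H.left_mem hg hy
      (heq ▸ inner_luneCenter_self g h)
  · rw [heq, (H.isFarthest.isLunePair hcut).sqrt_smul_luneCenter]

/-- The plane orthogonal to `k` touches `V` precisely in `v`, with `V` on its positive side. -/
structure Exposes (k : E3) (V : Set S2) (v : S2) : Prop where
  mem : v ∈ V
  inner_eq_zero : ⟪k, (v : E3)⟫_ℝ = 0
  inner_pos : ∀ x ∈ V, x ≠ v → 0 < ⟪k, (x : E3)⟫_ℝ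

theorem Exposes.mem_dualCone (hk : Exposes k V v) : k ∈ dualCone V := fun x hx => by
  rcases eq_or_ne x v with rfl | hne
  · exact hk.inner_eq_zero.ge
  · exact (hk.inner_pos x hx hne).le

theorem Exposes.inner_pos_of_mem_interior (hk : Exposes k V v) (hx : x ∈ interior V) :
    0 < ⟪k, (x : E3)⟫_ℝ := by
  refine SphericalPolygon.inner_pos_of_mem_interior hk.mem_dualCone ?_ hx
  rintro rfl
  have hsub : ∀ y ∈ V, y = x := fun y hy => by
    by_contra hne
    rcases eq_or_ne y v with rfl | hyv
    · simpa using hk.inner_pos x (interior_subset hx) (Ne.symm hne)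
    · simpa using hk.inner_pos y hy hyv
  obtain ⟨w, hxw, hw⟩ := exists_inner_eq_zero_notMem_span_singleton (x : E3) 0
  have hw0 : w ≠ 0 := by
    rintro rfl
    exact hw (Submodule.zero_mem _)
  have hwV : w ∈ dualCone V := fun y hy => by rw [hsub y hy, real_inner_comm, hxw]
  have := SphericalPolygon.inner_pos_of_mem_interior hwV hw0 hx
  rw [real_inner_comm, hxw] at this
  exact this.false

theorem IsReduced.eventually_exists_isCutLune (hV : IsReduced V) (H₀ : IsFarthestPair V g₀ h₀)
    (hk : Exposes k V v) (hm : 0 < ⟪m, (v : E3)⟫_ℝ) :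
    ∀ᶠ δ in 𝓝[>] (0 : ℝ), ∃ q : S2 × S2 × S2,
      IsCutLune V (k - δ • m) ⟪(g₀ : E3), (h₀ : E3)⟫_ℝ q.1 q.2.1 q.2.2 := by
  obtain ⟨x, hx⟩ := hV.1.2.2
  have hcont : ContinuousAt (fun δ : ℝ => ⟪k - δ • m, (x : E3)⟫_ℝ) 0 := by fun_prop
  filter_upwards [self_mem_nhdsWithin, nhdsWithin_le_nhds (hcont.eventually
    (lt_mem_nhds (by simpa using hk.inner_pos_of_mem_interior hx)))] with δ hδ hδx
  have hδ : 0 < δ := hδ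
  have hδv : ⟪k - δ • m, (v : E3)⟫_ℝ < 0 := by
    rw [inner_sub_left, hk.inner_eq_zero, real_inner_smul_left, zero_sub, neg_lt_zero]
    exact mul_pos hδ hm
  obtain ⟨g, h, y, hghy⟩ := hV.exists_isCutLune H₀ hx hδx hk.mem hδv
  exact ⟨(g, h, y), hghy⟩

section Limit

variable {l : Filter ℝ} [l.NeBot] {p : ℝ → S2}

theorem Exposes.mem_dualCone_of_tendsto (hk : Exposes k V v) (hl : l ≤ 𝓝 0) {q : ℝ → S2}
    (hq : Tendsto q l (𝓝 g)) (hp : Tendsto p l (𝓝 v))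
    (hqV : ∀ᶠ δ in l, (q δ : E3) ∈ dualCone (cut V (k - δ • m)))
    (hpV : ∀ᶠ δ in l, p δ ∈ cut V (k - δ • m)) : (g : E3) ∈ dualCone V := by
  have hq' : Tendsto (fun δ => (q δ : E3)) l (𝓝 g) :=
    (continuous_subtype_val.tendsto g).comp hq
  intro x hx
  rcases eq_or_ne x v with rfl | hne
  · refine ge_of_tendsto (hq'.inner ((continuous_subtype_val.tendsto _).comp hp)) ?_
    filter_upwards [hqV, hpV] with δ hδ hδp
    exact hδ _ hδp
  · have hcont : ContinuousAt (fun δ : ℝ => ⟪k - δ • m, (x : E3)⟫_ℝ) 0 := by fun_prop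
    have hpos := hl (hcont.eventually (lt_mem_nhds (by simpa using hk.inner_pos x hx hne)))
    refine ge_of_tendsto (hq'.inner tendsto_const_nhds) ?_
    filter_upwards [hqV, hpos] with δ hδ hδx
    exact hδ x ⟨hx, le_of_lt hδx⟩

theorem Exposes.eq_of_tendsto (hk : Exposes k V v) (hcl : IsClosed V) (hl : l ≤ 𝓝 0)
    (hp : Tendsto p l (𝓝 y)) (hpV : ∀ᶠ δ in l, p δ ∈ V)
    (hp0 : ∀ᶠ δ in l, ⟪k - δ • m, (p δ : E3)⟫_ℝ = 0) : y = v := by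
  by_contra hne
  have hlim : Tendsto (fun δ : ℝ => ⟪k - δ • m, (p δ : E3)⟫_ℝ) l
      (𝓝 ⟪k - (0 : ℝ) • m, (y : E3)⟫_ℝ) :=
    (tendsto_const_nhds.sub ((tendsto_id'.mpr hl).smul_const m)).inner
      ((continuous_subtype_val.tendsto y).comp hp)
  rw [zero_smul, sub_zero] at hlim
  exact (hk.inner_pos y (hcl.mem_of_tendsto hp hpV) hne).ne
    (tendsto_nhds_unique (tendsto_const_nhds.congr' (hp0.mono fun _ h => h.symm)) hlim)

end Limit

theorem IsReduced.exists_luneCenter_eq (hV : IsReduced V) (hk : Exposes k V v) :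
    ∃ g h, IsFarthestPair V g h ∧ luneCenter g h = v := by
  obtain ⟨m, -, hm⟩ := hV.1.exists_forall_inner_pos
  obtain ⟨g₀, h₀, H₀⟩ := hV.1.exists_isFarthestPair
  obtain ⟨f, hf⟩ := (hV.eventually_exists_isCutLune H₀ hk (hm v hk.mem)).choice
  let l := Ultrafilter.of (𝓝[>] (0 : ℝ))
  have hl : (l : Filter ℝ) ≤ 𝓝[>] 0 := Ultrafilter.of_le _
  have hl0 : (l : Filter ℝ) ≤ 𝓝 0 := hl.trans nhdsWithin_le_nhds
  obtain ⟨⟨g, h, y⟩, hlim⟩ : ∃ q, Tendsto f l (𝓝 q) := ⟨_, (l.map f).le_nhds_lim⟩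
  have hfl := hf.filter_mono hl
  have hg := hlim.fst_nhds
  have hh := hlim.snd_nhds.fst_nhds
  have hy := hlim.snd_nhds.snd_nhds
  obtain rfl : y = v := hk.eq_of_tendsto hV.1.2.1 hl0 hy (hfl.mono fun δ hδ => hδ.mem.1)
    (hfl.mono fun δ hδ => hδ.inner_eq_zero)
  have hcoe (x : S2) : Tendsto ((↑) : S2 → E3) (𝓝 x) (𝓝 x) := continuous_subtype_val.tendsto x
  have hgh := ((hcoe g).comp hg).inner (𝕜 := ℝ) ((hcoe h).comp hh)
  have hle := le_of_tendsto hgh (hfl.mono fun δ hδ => hδ.inner_le)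
  have heq := tendsto_nhds_unique_of_eventuallyEq
    (((hgh.pow 2).const_sub 1).sqrt.smul ((hcoe y).comp hy))
    (((hcoe h).comp hh).sub (hgh.smul ((hcoe g).comp hg))) (hfl.mono fun δ hδ => hδ.sqrt_smul)
  have hycut := hfl.mono fun δ hδ => hδ.mem
  have H : IsFarthestPair V g h :=
    ⟨hk.mem_dualCone_of_tendsto hl0 hg hy (hfl.mono fun δ hδ => hδ.left_mem) hycut,
      hk.mem_dualCone_of_tendsto hl0 hh hy (hfl.mono fun δ hδ => hδ.right_mem) hycut,
      fun a b ha hb => hle.trans (H₀.inner_le a b ha hb)⟩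
  have hlune := H.isFarthest.isLunePair hV.1
  exact ⟨g, h, H, smul_right_injective E3 hlune.sqrt_pos.ne'
    (hlune.sqrt_smul_luneCenter.trans heq.symm)⟩

end Reduced

section Polygon

variable {x v g h : S2} {C F G : Set S2} {k z : E3}

theorem subset_hull (F : Set S2) : F ⊆ hull F := fun _ hx _ hC => hC.2 hx

theorem IsConvex.hull_subset (hC : IsConvex C) (hF : F ⊆ C) : hull F ⊆ C :=
  fun _ hx => hx C ⟨hC, hF⟩

theorem hull_subset_hull (hFG : F ⊆ hull G) : hull F ⊆ hull G :=
  fun _ hx C hC => hx C ⟨hC.1, hFG.trans (hC.1.hull_subset hC.2)⟩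

theorem IsConvex.isConvex_hull (hC : IsConvex C) (hF : F ⊆ C) : IsConvex (hull F) :=
  ⟨fun a ha hna => hC.1 a (hC.hull_subset hF ha) (hC.hull_subset hF hna),
    fun a ha b hb _ hx D hD => hD.1.2 a (ha D hD) b (hb D hD) hx⟩

theorem nonempty_of_nonempty_hull (hF : (hull F).Nonempty) : F.Nonempty := by
  by_contra! hempty
  have hconv : IsConvex (∅ : Set S2) := ⟨fun a ha => ha.elim, fun a ha => ha.elim⟩
  obtain ⟨x, hx⟩ := hF
  exact hconv.hull_subset hempty.subset hx

/-- The points of `F` are in convex position, so that they are the vertices of `hull F`. -/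
def IsVertexSet (F : Set S2) : Prop := ∀ v ∈ F, v ∉ hull (F \ {v})

theorem exists_isVertexSet_hull_eq (hF : F.Finite) : ∃ G ⊆ F, IsVertexSet G ∧ hull G = hull F := by
  have hfin : {G | G ⊆ F ∧ hull G = hull F}.Finite := hF.finite_subsets.subset fun G hG => hG.1
  obtain ⟨G, hG⟩ := hfin.exists_minimal ⟨F, subset_rfl, rfl⟩
  refine ⟨G, hG.prop.1, fun v hv hmem => ?_, hG.prop.2⟩
  have hsub : G ⊆ hull (G \ {v}) := fun x hx => by
    rcases eq_or_ne x v with rfl | hne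
    · exact hmem
    · exact subset_hull _ ⟨hx, hne⟩
  have hdiff : hull (G \ {v}) = hull F :=
    hG.prop.2 ▸ (hull_subset_hull (Set.sdiff_subset.trans (subset_hull G))).antisymm
      (hull_subset_hull hsub)
  exact (hG.le_of_le ⟨Set.sdiff_subset.trans hG.prop.1, hdiff⟩ Set.sdiff_subset hv).2 rfl

theorem IsPolygon.exists_isVertexSet (hC : IsPolygon C) :
    ∃ F, F.Finite ∧ IsVertexSet F ∧ hull F = C := by
  obtain ⟨-, F, hF, -, rfl⟩ := hC
  obtain ⟨G, hGF, hG⟩ := exists_isVertexSet_hull_eq hF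
  exact ⟨G, hF.subset hGF, hG⟩

theorem IsConvex.isConvex_setOf_eq_or_inner_pos (hC : IsConvex C) (hkv : ⟪k, (v : E3)⟫_ℝ = 0) :
    IsConvex {x ∈ C | x = v ∨ 0 < ⟪k, (x : E3)⟫_ℝ} := by
  have hnonneg : ∀ x : S2, x = v ∨ 0 < ⟪k, (x : E3)⟫_ℝ → 0 ≤ ⟪k, (x : E3)⟫_ℝ := by
    rintro x (rfl | hx)
    exacts [hkv.ge, hx.le]
  refine ⟨fun a ha hna => hC.1 a ha.1 hna.1, fun a ha b hb x hx => ⟨hC.2 a ha.1 b hb.1 hx, ?_⟩⟩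
  obtain ⟨s, t, hs, ht, heq⟩ := hx
  rcases hs.eq_or_lt with rfl | hs
  · rw [zero_smul, zero_add] at heq
    exact eq_of_coe_eq_smul ht heq ▸ hb.2
  rcases ht.eq_or_lt with rfl | ht
  · rw [zero_smul, add_zero] at heq
    exact eq_of_coe_eq_smul hs.le heq ▸ ha.2
  have hinner : ⟪k, (x : E3)⟫_ℝ = s * ⟪k, (a : E3)⟫_ℝ + t * ⟪k, (b : E3)⟫_ℝ := by
    rw [heq, inner_add_right, inner_smul_right, inner_smul_right]
  rw [hinner]
  rcases ha.2 with rfl | hka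
  · rcases hb.2 with rfl | hkb
    · rw [← add_smul] at heq
      exact Or.inl (eq_of_coe_eq_smul (add_pos hs ht).le heq)
    · exact Or.inr (add_pos_of_nonneg_of_pos (mul_nonneg hs.le hkv.ge) (mul_pos ht hkb))
  · exact Or.inr (add_pos_of_pos_of_nonneg (mul_pos hs hka) (mul_nonneg ht.le (hnonneg b hb.2)))

theorem exposes_hull (hconv : IsConvex (hull F)) (hv : v ∈ F) (hkv : ⟪k, (v : E3)⟫_ℝ = 0)
    (hk : ∀ x ∈ F, x ≠ v → 0 < ⟪k, (x : E3)⟫_ℝ) : Exposes k (hull F) v := by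
  have hsub : hull F ⊆ {x ∈ hull F | x = v ∨ 0 < ⟪k, (x : E3)⟫_ℝ} :=
    (hconv.isConvex_setOf_eq_or_inner_pos hkv).hull_subset fun x hx =>
      ⟨subset_hull F hx, or_iff_not_imp_left.mpr (hk x hx)⟩
  exact ⟨subset_hull F hv, hkv, fun x hx hne => (hsub hx).2.resolve_left hne⟩

theorem IsVertexSet.exists_exposes (hvert : IsVertexSet F) (hF : F.Finite)
    (hconv : IsConvex (hull F)) (hv : v ∈ F) : ∃ k, Exposes k (hull F) v := by
  obtain ⟨m, hm, -⟩ := hconv.exists_inner_pos_of_notMem hF.isClosed (subset_hull F)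
    (zero_notMem_cone _)
  obtain ⟨k, hk, hkv⟩ := (hconv.isConvex_hull (Set.sdiff_subset.trans (subset_hull F))
    ).exists_inner_pos_of_notMem (hF.sdiff.isClosed) (subset_hull (F \ {v}))
    (coe_mem_cone_iff.not.mpr (hvert v hv))
  have hmv := hm v hv
  refine ⟨k + (-⟪k, (v : E3)⟫_ℝ / ⟪m, (v : E3)⟫_ℝ) • m, exposes_hull hconv hv ?_ ?_⟩
  · rw [inner_add_left, real_inner_smul_left, div_mul_cancel₀ _ hmv.ne', add_neg_cancel]
  · intro x hx hne
    rw [inner_add_left, real_inner_smul_left]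
    exact add_pos_of_pos_of_nonneg (hk x ⟨hx, hne⟩)
      (mul_nonneg (div_nonneg (neg_nonneg.mpr hkv) hmv.le) (hm x hx).le)

theorem Exposes.eventually_add_smul (hk : Exposes k (hull F) v) (hF : F.Finite) (hv : v ∈ F)
    (hconv : IsConvex (hull F)) (hz : ⟪z, (v : E3)⟫_ℝ = 0) :
    ∀ᶠ ε in 𝓝 (0 : ℝ), Exposes (k + ε • z) (hull F) v := by
  have hpos : ∀ᶠ ε in 𝓝 (0 : ℝ), ∀ x ∈ F, x ≠ v → 0 < ⟪k + ε • z, (x : E3)⟫_ℝ := by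
    refine (hF.eventually_all).mpr fun x hx => ?_
    by_cases hne : x = v
    · exact .of_forall fun ε h => absurd hne h
    have hcont : ContinuousAt (fun ε : ℝ => ⟪k + ε • z, (x : E3)⟫_ℝ) 0 := by fun_prop
    filter_upwards [hcont.eventually
      (lt_mem_nhds (by simpa using hk.inner_pos x (subset_hull F hx) hne))] with ε hε _ using hε
  filter_upwards [hpos] with ε hε
  refine exposes_hull hconv hv ?_ hε
  rw [inner_add_left, real_inner_smul_left, hk.inner_eq_zero, hz, mul_zero, add_zero]

theorem IsFarthestPair.mem_span_of_inner_luneCenter_eq_zero (H : IsFarthestPair C g h)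
    (hgh : IsLunePair g h) (hpos : 0 < ⟪(g : E3), (h : E3)⟫_ℝ) (hz : z ∈ dualCone C)
    (hz0 : ⟪z, luneCenter g h⟫_ℝ = 0) : z ∈ Submodule.span ℝ {(g : E3)} := by
  have hzh : ⟪z, (h : E3)⟫_ℝ = ⟪(g : E3), (h : E3)⟫_ℝ * ⟪z, (g : E3)⟫_ℝ := by
    have hinner := congrArg (fun w => ⟪z, w⟫_ℝ) hgh.sqrt_smul_luneCenter
    simp only [inner_sub_right, inner_smul_right, hz0, mul_zero] at hinner
    linarith
  have hle := H.symm.isFarthest.mul_norm_le hz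
  rw [real_inner_comm, real_inner_comm z, hzh] at hle
  have hcauchy : ⟪z, (g : E3)⟫_ℝ = ‖z‖ * ‖(g : E3)‖ :=
    (real_inner_le_norm _ _).antisymm (by
      rw [norm_coe, mul_one]
      exact le_of_mul_le_mul_left hle hpos)
  rw [inner_eq_norm_mul_iff_real, norm_coe, one_smul] at hcauchy
  exact hcauchy ▸ Submodule.smul_mem _ _ (Submodule.mem_span_singleton_self _)

theorem IsReduced.thickness_hull_le_pi_div_two (hred : IsReduced (hull F)) (hF : F.Finite)
    (hvert : IsVertexSet F) : thickness (hull F) ≤ Real.pi / 2 := by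
  have hconv := hred.1.1
  obtain ⟨v, hv⟩ := nonempty_of_nonempty_hull (hred.1.2.2.mono interior_subset)
  obtain ⟨k, hk⟩ := hvert.exists_exposes hF hconv hv
  obtain ⟨g, h, H, hgh⟩ := hred.exists_luneCenter_eq hk
  have hlune := H.isFarthest.isLunePair hred.1
  rw [H.thickness_eq hred.1, hlune.luneThickness_eq, Real.arccos_le_pi_div_two, neg_nonneg]
  by_contra! hpos
  have hspan : ∀ z, Exposes z (hull F) v → z ∈ Submodule.span ℝ {(g : E3)} := fun z hz =>
    H.mem_span_of_inner_luneCenter_eq_zero hlune hpos hz.mem_dualCone (hgh ▸ hz.inner_eq_zero)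
  obtain ⟨w, hvw, hw⟩ := exists_inner_eq_zero_notMem_span_singleton (v : E3) (g : E3)
  obtain ⟨ε, hε, hne⟩ := ((hk.eventually_add_smul hF hv hconv
    ((real_inner_comm _ _).trans hvw)).filter_mono nhdsWithin_le_nhds |>.and
      (self_mem_nhdsWithin : {0}ᶜ ∈ 𝓝[≠] (0 : ℝ))).exists
  refine hw ?_
  rw [← Submodule.smul_mem_iff _ hne, ← Submodule.add_mem_iff_right _ (hspan k hk)]
  exact hspan _ hε

end Polygon

section Disk

variable {g h p x : S2} {C : Set S2} {ρ : ℝ}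

theorem mem_disk_iff (h0 : 0 ≤ ρ) (hπ : ρ ≤ Real.pi) :
    x ∈ disk p ρ ↔ Real.cos ρ ≤ ⟪(p : E3), (x : E3)⟫_ℝ := by
  rw [← cos_sdist]
  exact (Real.strictAntiOn_cos.le_iff_ge ⟨h0, hπ⟩
    ⟨InnerProductGeometry.angle_nonneg _ _, InnerProductGeometry.angle_le_pi _ _⟩).symm

theorem IsConvex.inter_disk (hC : IsConvex C) (p : S2) (h0 : 0 ≤ ρ) (hρ : ρ ≤ Real.pi / 2) :
    IsConvex (C ∩ disk p ρ) := by
  have hπ : ρ ≤ Real.pi := by linarith [Real.pi_pos]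
  have hcos : 0 ≤ Real.cos ρ := Real.cos_nonneg_of_neg_pi_div_two_le_of_le (by linarith) hρ
  refine ⟨fun a ha hna => hC.1 a ha.1 hna.1, fun a ha b hb x hx => ⟨hC.2 a ha.1 b hb.1 hx, ?_⟩⟩
  have hpa := (mem_disk_iff h0 hπ).mp ha.2
  have hpb := (mem_disk_iff h0 hπ).mp hb.2
  obtain ⟨s, t, hs, ht, heq⟩ := hx
  have hst : 1 ≤ s + t := by
    simpa only [← heq, norm_smul_of_nonneg hs, norm_smul_of_nonneg ht, norm_coe, mul_one]
      using norm_add_le (s • (a : E3)) (t • (b : E3))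
  rw [mem_disk_iff h0 hπ]
  calc Real.cos ρ ≤ (s + t) * Real.cos ρ := le_mul_of_one_le_left hcos hst
    _ = s * Real.cos ρ + t * Real.cos ρ := add_mul _ _ _
    _ ≤ s * ⟪(p : E3), (a : E3)⟫_ℝ + t * ⟪(p : E3), (b : E3)⟫_ℝ := by gcongr
    _ = ⟪(p : E3), (x : E3)⟫_ℝ := by
      rw [heq, inner_add_right, inner_smul_right, inner_smul_right]

theorem IsFarthestPair.isShortArc (H : IsFarthestPair C g h) (hC : IsConvexBody C)
    (hle : thickness C ≤ Real.pi / 2) : IsShortArc (luneCenter g h) (luneCenter h g) := by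
  have hlune := H.isFarthest.isLunePair hC
  refine ⟨hlune.norm_luneCenter, hlune.symm.norm_luneCenter, ?_, ?_⟩
  · rwa [H.thickness_eq hC, hlune.luneThickness_eq, Real.arccos_le_pi_div_two,
      ← hlune.inner_luneCenter_luneCenter] at hle
  · rw [hlune.inner_luneCenter_luneCenter]
    linarith [neg_one_lt_inner_coe hlune.2]

theorem IsFarthestPair.luneCenter_mem_perpLune {a b : S2} (H : IsFarthestPair C g h)
    (H' : IsFarthestPair C a b) (hC : IsConvexBody C) :
    luneCenter a b ∈ perpLune (luneCenter g h) (luneCenter h g) := by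
  obtain ⟨x, hx, hxeq⟩ := H'.symm.isFarthest.exists_coe_eq_luneCenter hC
  exact hxeq ▸ (H.isFarthest.isLunePair hC).mem_perpLune H.left_mem H.right_mem hx

theorem IsFarthestPair.mutualPerpLunes {a b : S2} (H : IsFarthestPair C g h)
    (H' : IsFarthestPair C a b) (hC : IsConvexBody C) (hle : thickness C ≤ Real.pi / 2) :
    MutualPerpLunes (luneCenter g h) (luneCenter h g) (luneCenter a b) (luneCenter b a) :=
  ⟨H.isShortArc hC hle, H'.isShortArc hC hle, H.luneCenter_mem_perpLune H' hC,
    H.luneCenter_mem_perpLune H'.symm hC, H'.luneCenter_mem_perpLune H hC,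
    H'.luneCenter_mem_perpLune H.symm hC⟩

theorem IsConvex.sdist_lt_pi (hC : IsConvex C) (hp : p ∈ C) (hx : x ∈ C) :
    sdist p x < Real.pi := by
  refine (InnerProductGeometry.angle_le_pi _ _).lt_of_ne fun hπ => ?_
  obtain ⟨-, r, hr, heq⟩ := InnerProductGeometry.angle_eq_pi_iff.mp hπ
  have hneg : x = -p := eq_of_coe_eq_smul (neg_nonneg.mpr hr.le) (by simp [heq])
  exact hC.1 p hp (hneg ▸ hx)

theorem IsConvexBody.exists_forall_angle_luneCenter_le {ι : Type*} [Finite ι] [Nonempty ι]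
    (hC : IsConvexBody C) (hle : thickness C ≤ Real.pi / 2) {g h : ι → S2}
    (H : ∀ i, IsFarthestPair C (g i) (h i)) :
    ∃ i, ∀ j, InnerProductGeometry.angle (luneCenter (h i) (g i)) (luneCenter (g j) (h j)) ≤
      thickness C := by
  have hlune i := (H i).isFarthest.isLunePair hC
  have hπ i j : InnerProductGeometry.angle (luneCenter (h i) (g i)) (luneCenter (g j) (h j)) <
      Real.pi := by
    obtain ⟨p, hp, hpeq⟩ := (H i).isFarthest.exists_coe_eq_luneCenter hC
    obtain ⟨x, hx, hxeq⟩ := (H j).symm.isFarthest.exists_coe_eq_luneCenter hC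
    exact hpeq ▸ hxeq ▸ hC.1.sdist_lt_pi hp hx
  have hsep i j (l : E3) (ht : 0 < ⟪l, luneCenter (h i) (g i)⟫_ℝ)
      (hv : 0 < ⟪l, luneCenter (g i) (h i)⟫_ℝ) (ht' : ⟪l, luneCenter (h j) (g j)⟫_ℝ ≤ 0) :
      0 < ⟪l, luneCenter (g j) (h j)⟫_ℝ := by
    by_contra! hv'
    have hindep := ((H i).mutualPerpLunes (H j) hC hle).linearIndependent_of_separated hv ht hv' ht'
    simpa using hindep.fintype_card_le_finrank
  obtain ⟨i, hi⟩ := exists_forall_angle_le (fun i => (hlune i).symm.norm_luneCenter)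
    (fun i => (hlune i).norm_luneCenter) hπ hsep
  refine ⟨i, fun j => (hi j).trans_eq ?_⟩
  rw [(H i).thickness_eq hC, luneThickness, InnerProductGeometry.angle_comm]

end Disk

end SphericalPolygon

open SphericalPolygon in
theorem mainTheorem2 (V : Set SphericalPolygon.S2) (hV : SphericalPolygon.IsPolygon V)
    (hred : SphericalPolygon.IsReduced V) :
    SphericalPolygon.thickness V ∈ Set.Ioc 0 (Real.pi / 2) ∧
      ∃ p ∈ frontier V, V ⊆ SphericalPolygon.disk p (SphericalPolygon.thickness V) := by
  obtain ⟨F, hF, hvert, rfl⟩ := hV.exists_isVertexSet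
  have hpos := hred.1.thickness_pos
  have hle := hred.thickness_hull_le_pi_div_two hF hvert
  have : Finite F := hF
  have : Nonempty F :=
    (nonempty_of_nonempty_hull (hred.1.2.2.mono interior_subset)).to_subtype
  have hpairs (v : F) : ∃ g h, IsFarthestPair (hull F) g h ∧ luneCenter g h = v :=
    have ⟨_, hk⟩ := hvert.exists_exposes hF hred.1.1 v.2
    hred.exists_luneCenter_eq hk
  choose g h H hv using hpairs
  obtain ⟨i, hi⟩ := hred.1.exists_forall_angle_luneCenter_le hle H
  obtain ⟨p, hp, hpeq⟩ := (H i).isFarthest.exists_coe_eq_luneCenter hred.1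
  have hfrontier : p ∈ frontier (hull F) :=
    mem_frontier_of_inner_eq_zero (H i).right_mem hp (hpeq ▸ inner_luneCenter_self _ _)
  have hdist (v : F) : sdist p v ≤ thickness (hull F) := by
    rw [sdist, hpeq, ← hv v]
    exact hi v
  have hdisk : F ⊆ hull F ∩ disk p (thickness (hull F)) := fun v hvF =>
    ⟨subset_hull F hvF, hdist ⟨v, hvF⟩⟩
  exact ⟨⟨hpos, hle⟩, p, hfrontier, fun x hx =>
    ((hred.1.1.inter_disk p hpos.le hle).hull_subset hdisk hx).2⟩
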